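/- Machine model: a deterministic word RAM with words of $O(\log N)$ bits, where $N$ is the size of the input (for a directed graph, its number of vertices plus its number of edges; for a coverability instance, the size $n$ defined below); the constant in the $O(\cdot)$ may depend on the algorithm. The \emph{$k$-cycle hypothesis} states: for every $\varepsilon>0$ there is an integer $k\ge 1$ such that no deterministic algorithm decides in time $O(m^{2-\varepsilon})$ whether a given directed graph with $m$ edges contains a (simple directed) cycle of length $k$. A \emph{unary $2$-VASS} $\mathcal V=(Q,T)$ consists of a finite non-empty set $Q$ of states and a finite non-empty set $T\subseteq Q\times\{-1,0,1\}^2\times Q$ of transitions; its size is $|Q|+|T|$. A configuration $q(\mathbf v)$ is a pair in $Q\times\mathbb N^2$, and there is a step from $p(\mathbf u)$ to $q(\mathbf v)$ if $(p,\mathbf v-\mathbf u,q)\in T$; counter values are not bounded from above. An instance of \emph{coverability} consists of a unary $2$-VASS $\mathcal V$ and two configurations $p(\mathbf u)$, $q(\mathbf v)$; the question is whether a finite (possibly empty) sequence of steps leads from $p(\mathbf u)$ to some $q(\mathbf v')$ with $\mathbf v'\ge\mathbf v$ componentwise. The size of the instance is $n=|Q|+|T|+\|\mathbf u\|+\|\mathbf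 v\|$, where $\|\mathbf v\|=\max\{1,|\mathbf v[1]|,|\mathbf v[2]|\}$. \textbf{Corollary.} Assume the $k$-cycle hypothesis. Then coverability in unary $2$-VASS requires $n^{2-o(1)}$ time; that is, for every $\varepsilon>0$, no deterministic algorithm decides coverability in unary $2$-VASS in time $O(n^{2-\varepsilon})$, where $n$ is the size of the instance. -/

import Mathlib

/-! ### Deterministic word RAM -/

namespace WordRAM

/-- Binary operations on words, each executed in one step. -/
inductive BinOp
  | add | sub | mul | div | mod | and | or | xor | shiftLeft | shiftRight

/-- The value of an operation on natural numbers; subtraction is truncated at `0`. -/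
def BinOp.eval : BinOp → ℕ → ℕ → ℕ
  | .add, a, b => a + b
  | .sub, a, b => a - b
  | .mul, a, b => a * b
  | .div, a, b => a / b
  | .mod, a, b => a % b
  | .and, a, b => a &&& b
  | .or, a, b => a ||| b
  | .xor, a, b => a ^^^ b
  | .shiftLeft, a, b => a <<< b
  | .shiftRight, a, b => a >>> b

/-- Instructions; `L` is the set of program labels, and registers are named by natural numbers. -/
inductive Instr (L : Type)
  /-- stop and accept (`true`) or reject (`false`) -/
  | halt (answer : Bool)
  /-- `R[dst] := v` -/
  | const (dst v : ℕ) (next : L)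
  /-- `R[dst] := R[a] op R[b]` -/
  | op (o : BinOp) (dst a b : ℕ) (next : L)
  /-- `R[dst] := M[R[addr]]` -/
  | load (dst addr : ℕ) (next : L)
  /-- `M[R[addr]] := R[src]` -/
  | store (addr src : ℕ) (next : L)
  /-- conditional jump on `R[a] < R[b]` -/
  | branchLt (a b : ℕ) (yes no : L)
  /-- conditional jump on `R[a] = R[b]` -/
  | branchEq (a b : ℕ) (yes no : L)

/-- A program: finitely many labels, an instruction at each label, and a start label. It therefore
mentions only finitely many registers. -/
structure Program where
  Label : Type
  finite : Finite Label
  start : Label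
  instr : Label → Instr Label

/-- A configuration: the current label, the registers and the memory. -/
structure Config (P : Program) where
  label : P.Label
  reg : ℕ → ℕ
  mem : ℕ → ℕ

/-- One step with words of `w` bits. Every value that is written has to be a word, that is, smaller
than `2 ^ w`; an instruction whose result does not fit is an error (there is no next configuration).
Arithmetic modulo a power of two is available through `mod`. There is no next configuration
either at a `halt`. -/
def step (P : Program) (w : ℕ) (c : Config P) : Option (Config P) :=
  match P.instr c.label with
  | .halt _ => none
  | .const dst v next =>
      if v < 2 ^ w then some ⟨next, Function.update c.reg dst v, c.mem⟩ else none
  | .op o dst a b next =>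
      if o.eval (c.reg a) (c.reg b) < 2 ^ w then
        some ⟨next, Function.update c.reg dst (o.eval (c.reg a) (c.reg b)), c.mem⟩
      else none
  | .load dst addr next =>
      some ⟨next, Function.update c.reg dst (c.mem (c.reg addr)), c.mem⟩
  | .store addr src next =>
      some ⟨next, c.reg, Function.update c.mem (c.reg addr) (c.reg src)⟩
  | .branchLt a b yes no => some ⟨if c.reg a < c.reg b then yes else no, c.reg, c.mem⟩
  | .branchEq a b yes no => some ⟨if c.reg a = c.reg b then yes else no, c.reg, c.mem⟩

/-- `HaltsIn P w c t b`: with `w`-bit words, the run of `P` from `c` executes exactly `t`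
instructions, the last one being `halt b`. -/
inductive HaltsIn (P : Program) (w : ℕ) : Config P → ℕ → Bool → Prop
  | halt {c : Config P} {b : Bool} (h : P.instr c.label = .halt b) : HaltsIn P w c 1 b
  | step {c c' : Config P} {t : ℕ} {b : Bool} (h : step P w c = some c')
      (h' : HaltsIn P w c' t b) : HaltsIn P w c (t + 1) b

/-- The initial configuration: the input occupies the memory cells `0, 1, 2, …`, and all the other
cells and all registers hold `0`. -/
def init (P : Program) (input : List ℕ) : Config P :=
  ⟨P.start, fun _ => 0, fun i => input.getD i 0⟩

/-- The decision problem `yes` on instances `I`, encoded by `enc`, can be decided deterministically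
in time `O(T)` on a word RAM with words of `O(log len)` bits: one program and two constants
`c`, `C` serve all instances. -/
def DecidableInTime {I : Type} (enc : I → List ℕ) (yes : I → Prop) (len : I → ℕ) (T : I → ℝ) :
    Prop :=
  ∃ (P : Program) (c : ℕ) (C : ℝ), ∀ x : I, ∃ (t : ℕ) (b : Bool),
    HaltsIn P (c * (Nat.log 2 (len x) + 1)) (init P (enc x)) t b ∧
      (b = true ↔ yes x) ∧ (t : ℝ) ≤ C * T x

end WordRAM

/-! ### Directed cycles of length `k` -/

/-- `G` contains a (simple, directed) cycle of length `k`, for `k` positive. -/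
def Digraph.HasCycle {V : Type*} (G : Digraph V) (k : ℕ) : Prop :=
  ∃ v : ZMod k → V, Function.Injective v ∧ ∀ i, G.Adj (v i) (v (i + 1))

/-- A finite directed graph on the vertices `0, …, n - 1`, given by a list of its edges. -/
structure DigraphInput where
  n : ℕ
  G : Digraph (Fin n)
  edges : List (Fin n × Fin n)
  nodup : edges.Nodup
  mem_edges : ∀ u v, (u, v) ∈ edges ↔ G.Adj u v

namespace DigraphInput

/-- The number of edges. -/
def m (x : DigraphInput) : ℕ := x.edges.length

/-- `n`, `m`, and then the two end points of each edge. -/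
def encode (x : DigraphInput) : List ℕ :=
  [x.n, x.m] ++ x.edges.flatMap fun e => [e.1.val, e.2.val]

end DigraphInput

/-- For every `ε > 0` there is some `k` such that no deterministic algorithm decides in time
`O(m ^ (2 - ε))` whether a directed graph with `m` edges has a cycle of length `k`.
(The bound is written with `m + 1` so that it is not `0` for a graph without edges.) -/
def KCycleHypothesis : Prop :=
  ∀ ε : ℝ, 0 < ε → ∃ k : ℕ, 1 ≤ k ∧
    ¬ WordRAM.DecidableInTime DigraphInput.encode (fun x => x.G.HasCycle k)
      (fun x => x.n + x.m) (fun x => ((x.m : ℝ) + 1) ^ (2 - ε))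

/-! ### Vector addition systems with states -/

/-- `max {1, |v 0|, …, |v (d - 1)|}`. -/
def vecNorm {d : ℕ} (v : Fin d → ℤ) : ℕ :=
  max 1 (Finset.univ.sup fun i => (v i).natAbs)

/-- A `d`-dimensional vector addition system with state set `Q`, given by its non-empty finite set
of transitions `(p, x, q)`. -/
structure VASS (d : ℕ) (Q : Type*) where
  T : Finset (Q × (Fin d → ℤ) × Q)
  nonempty : T.Nonempty

namespace VASS

variable {d : ℕ} {Q : Type*}

/-- A step between configurations `p(u)` and `q(v)`; counter values are non-negative. -/
def Step (V : VASS d Q) (c c' : Q × (Fin d → ℕ)) : Prop :=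
  ∃ x : Fin d → ℤ, (c.1, x, c'.1) ∈ V.T ∧ ∀ i, x i = (c'.2 i : ℤ) - (c.2 i : ℤ)

/-- There is a run from the first configuration to the second one. -/
def Reach (V : VASS d Q) : Q × (Fin d → ℕ) → Q × (Fin d → ℕ) → Prop :=
  Relation.ReflTransGen V.Step

/-- From the first configuration some configuration `q(v')` with `v ≤ v'` can be reached, where
`q(v)` is the second configuration. -/
def Covers (V : VASS d Q) (c c' : Q × (Fin d → ℕ)) : Prop :=
  ∃ v' : Fin d → ℕ, c'.2 ≤ v' ∧ V.Reach c (c'.1, v')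

/-- Every update has entries in `{-1, 0, 1}`. -/
def IsUnary (V : VASS d Q) : Prop :=
  ∀ t ∈ V.T, ∀ i, t.2.1 i = -1 ∨ t.2.1 i = 0 ∨ t.2.1 i = 1

/-- The size: the number of states plus the sum of the norms of the updates. -/
def size [Fintype Q] (V : VASS d Q) : ℕ :=
  Fintype.card Q + ∑ t ∈ V.T, vecNorm t.2.1

theorem IsUnary.size_eq [Fintype Q] {V : VASS d Q} (h : V.IsUnary) :
    V.size = Fintype.card Q + V.T.card := by
  have : ∀ t ∈ V.T, vecNorm t.2.1 = 1 := by
    intro t ht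
    refine max_eq_left (Finset.sup_le fun i _ => ?_)
    rcases h t ht i with h | h | h <;> simp [h]
  simp [size, Finset.sum_congr rfl this]

end VASS

/-- An instance of coverability in unary `d`-VASS: a unary `d`-VASS with states `0, …, q - 1`, given
by a list of its transitions, with an initial and a target configuration. -/
structure UnaryCoverInput (d : ℕ) where
  q : ℕ
  V : VASS d (Fin q)
  unary : V.IsUnary
  transitions : List (Fin q × (Fin d → ℤ) × Fin q)
  nodup : transitions.Nodup
  mem_transitions : ∀ t, t ∈ transitions ↔ t ∈ V.T
  source : Fin q × (Fin d → ℕ)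
  target : Fin q × (Fin d → ℕ)

namespace UnaryCoverInput

variable {d : ℕ}

/-- The size of the instance: that of the VASS plus the norms of the two vectors. -/
def size (x : UnaryCoverInput d) : ℕ :=
  x.V.size + vecNorm (fun i => (x.source.2 i : ℤ)) + vecNorm (fun i => (x.target.2 i : ℤ))

/-- State followed by counter values. -/
def encodeConfig {q : ℕ} (c : Fin q × (Fin d → ℕ)) : List ℕ :=
  c.1.val :: List.ofFn c.2

/-- The states of a transition around its update; the entries `-1, 0, 1` become `0, 1, 2`. -/
def encodeTransition {q : ℕ} (t : Fin q × (Fin d → ℤ) × Fin q) : List ℕ :=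
  t.1.val :: (List.ofFn fun i => (t.2.1 i + 1).toNat) ++ [t.2.2.val]

/-- Number of states, number of transitions, the two configurations, and the transitions. -/
def encode (x : UnaryCoverInput d) : List ℕ :=
  [x.q, x.transitions.length] ++ encodeConfig x.source ++ encodeConfig x.target ++
    x.transitions.flatMap encodeTransition

end UnaryCoverInput

/-!
A cycle through vertices of the colours `0, …, k - 1`, in this order, is a closed walk through `k`
layers of slots, where a slot is a pair of a colouring and a vertex. A 2-VASS finds such a walk. In
the first row of states it moves along a cyclic chain of `Z` slots from the configuration `(0, Z)`,
with the update `(1, -1)`, so that the counters remember the slot at which it leaves the chain. Then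
it follows `k` transitions, each with the update `(0, 0)` if it is an edge that fits the colouring
and the layer, and with `(-1, -1)` otherwise. In the last row it moves back with the update
`(-1, 1)`. It covers `(0, Z)` in the slot `0` if and only if the sum of the counters has never
dropped and the walk has returned to the slot in which it started. Since all the pairs of a
colouring and an edge are present, and only their updates depend on the graph, the size of the
output is known in advance.

For any `k` different vertices, some `k²` positions of bits tell them apart, so that one colouring
for each choice of positions and each table of colours for the resulting patterns is enough. These
are polylogarithmically many in the number `m` of edges, once the vertices are renamed to places in
the list of edges. The instance has size `m` up to such factors, and an algorithm for coverability
in time `O(n ^ (2 - ε))` would find cycles in time `O(m ^ (2 - ε'))`.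
-/

/-! ### Code fragments -/

namespace WordRAM

namespace Instr

variable {L L' L'' : Type}

/-- Renaming of the labels of an instruction. -/
def map (f : L → L') : Instr L → Instr L'
  | .halt b => .halt b
  | .const dst v next => .const dst v (f next)
  | .op o dst a b next => .op o dst a b (f next)
  | .load dst addr next => .load dst addr (f next)
  | .store addr src next => .store addr src (f next)
  | .branchLt a b yes no => .branchLt a b (f yes) (f no)
  | .branchEq a b yes no => .branchEq a b (f yes) (f no)

theorem map_map (f : L → L') (g : L' → L'') (i : Instr L) : (i.map f).map g = i.map (g ∘ f) := by
  cases i <;> rfl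

theorem map_congr {f g : L → L'} (h : ∀ l, f l = g l) (i : Instr L) : i.map f = i.map g := by
  rw [funext h]

end Instr

/-- `Steps P w t c c'`: the configuration `c'` is reached from `c` in exactly `t` steps. -/
def Steps (P : Program) (w : ℕ) : ℕ → Config P → Config P → Prop
  | 0, c, c' => c = c'
  | t + 1, c, c' => ∃ d, step P w c = some d ∧ Steps P w t d c'

namespace Steps

variable {P : Program} {w t t' : ℕ} {c d e : Config P}

theorem single (h : step P w c = some d) : Steps P w 1 c d :=
  ⟨d, h, rfl⟩

theorem trans (h : Steps P w t c d) (h' : Steps P w t' d e) : Steps P w (t + t') c e := by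
  induction t generalizing c with
  | zero => cases h; rwa [Nat.zero_add]
  | succ t ih =>
    obtain ⟨c', hc, hs⟩ := h
    rw [Nat.succ_add]
    exact ⟨c', hc, ih hs⟩

theorem haltsIn {b : Bool} (h : Steps P w t c d) (h' : HaltsIn P w d t' b) :
    HaltsIn P w c (t + t') b := by
  induction t generalizing c with
  | zero => cases h; rwa [Nat.zero_add]
  | succ t ih =>
    obtain ⟨c', hc, hs⟩ := h
    rw [Nat.succ_add]
    exact HaltsIn.step hc (ih hs)

end Steps

/-- A piece of code with one entry and one exit; a jump to `none` leaves it. -/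
structure Frag where
  Label : Type
  finite : Finite Label
  start : Label
  instr : Label → Instr (Option Label)

namespace Frag

/-- `P` contains the code `F` at the labels `e`, and continues at `x` behind it. -/
def Embeds (F : Frag) (P : Program) (e : F.Label → P.Label) (x : P.Label) : Prop :=
  ∀ l, P.instr (e l) = (F.instr l).map fun o => o.elim x e

/-- In every program that contains `F`, running `F` takes `t` steps and has the given effect on
registers and memory. -/
def Exec (F : Frag) (w : ℕ) (reg mem : ℕ → ℕ) (t : ℕ) (reg' mem' : ℕ → ℕ) : Prop :=
  ∀ (P : Program) (e : F.Label → P.Label) (x : P.Label), F.Embeds P e x →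
    Steps P w t ⟨e F.start, reg, mem⟩ ⟨x, reg', mem'⟩

/-- A single instruction. -/
def atom (i : Instr (Option Unit)) : Frag := ⟨Unit, inferInstance, (), fun _ => i⟩

/-- Sequential composition. -/
def seq (F G : Frag) : Frag where
  Label := F.Label ⊕ G.Label
  finite := by
    have := F.finite
    have := G.finite
    infer_instance
  start := .inl F.start
  instr
    | .inl l => (F.instr l).map fun o => some (o.elim (.inr G.start) .inl)
    | .inr l => (G.instr l).map (Option.map .inr)

/-- Repetition of a piece of code while register `a` is smaller than register `b`. -/
def loop (a b : ℕ) (F : Frag) : Frag where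
  Label := Option F.Label
  finite := by
    have := F.finite
    infer_instance
  start := none
  instr
    | none => .branchLt a b (some (some F.start)) none
    | some l => (F.instr l).map some

variable {F G : Frag} {w t t' : ℕ} {reg mem reg' mem' reg'' mem'' : ℕ → ℕ}

theorem exec_atom {i : Instr (Option Unit)}
    (h : ∀ (P : Program) (l x : P.Label), P.instr l = i.map (fun o => o.elim x fun _ => l) →
      step P w ⟨l, reg, mem⟩ = some ⟨x, reg', mem'⟩) :
    (atom i).Exec w reg mem 1 reg' mem' :=
  fun P e x hP => Steps.single (h P (e ()) x (hP ()))

theorem exec_const {d v : ℕ} (h : v < 2 ^ w) :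
    (atom (.const d v none)).Exec w reg mem 1 (Function.update reg d v) mem :=
  exec_atom fun P l x hP => by simp [step, hP, Instr.map, h]

theorem exec_op {o : BinOp} {d a b : ℕ} (h : o.eval (reg a) (reg b) < 2 ^ w) :
    (atom (.op o d a b none)).Exec w reg mem 1
      (Function.update reg d (o.eval (reg a) (reg b))) mem :=
  exec_atom fun P l x hP => by simp [step, hP, Instr.map, h]

theorem exec_load {d a : ℕ} :
    (atom (.load d a none)).Exec w reg mem 1 (Function.update reg d (mem (reg a))) mem :=
  exec_atom fun P l x hP => by simp [step, hP, Instr.map]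

theorem exec_store {a b : ℕ} :
    (atom (.store a b none)).Exec w reg mem 1 reg (Function.update mem (reg a) (reg b)) :=
  exec_atom fun P l x hP => by simp [step, hP, Instr.map]

/-- The instruction `R[d] := R[a] and R[a]`, which copies a register. -/
def copy (d a : ℕ) : Frag := atom (.op .and d a a none)

theorem exec_copy {d a : ℕ} (h : reg a < 2 ^ w) :
    (copy d a).Exec w reg mem 1 (Function.update reg d (reg a)) mem := by
  have and_self : BinOp.and.eval (reg a) (reg a) = reg a := Nat.and_self _
  have := exec_op (mem := mem) (d := d) (o := .and) (a := a) (b := a) (by rwa [and_self])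
  rwa [and_self] at this

theorem Embeds.left {P : Program} {e : (F.seq G).Label → P.Label} {x : P.Label}
    (h : (F.seq G).Embeds P e x) : F.Embeds P (e ∘ .inl) (e (.inr G.start)) := fun l => by
  refine (h (.inl l)).trans ((Instr.map_map _ _ _).trans (Instr.map_congr ?_ _))
  rintro (_ | _) <;> rfl

theorem Embeds.right {P : Program} {e : (F.seq G).Label → P.Label} {x : P.Label}
    (h : (F.seq G).Embeds P e x) : G.Embeds P (e ∘ .inr) x := fun l => by
  refine (h (.inr l)).trans ((Instr.map_map _ _ _).trans (Instr.map_congr ?_ _))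
  rintro (_ | _) <;> rfl

theorem Embeds.body {a b : ℕ} {P : Program} {e : (F.loop a b).Label → P.Label} {x : P.Label}
    (h : (F.loop a b).Embeds P e x) : F.Embeds P (e ∘ some) (e none) := fun l => by
  refine (h (some l)).trans ((Instr.map_map _ _ _).trans (Instr.map_congr ?_ _))
  rintro (_ | _) <;> rfl

theorem Embeds.step_test {a b : ℕ} {P : Program} {e : (F.loop a b).Label → P.Label} {x : P.Label}
    (h : (F.loop a b).Embeds P e x) :
    step P w ⟨e none, reg, mem⟩ =
      some ⟨if reg a < reg b then (e ∘ some) F.start else x, reg, mem⟩ := by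
  have test : P.instr (e none) = .branchLt a b (e (some F.start)) x := h none
  simp only [step, test]
  rfl

theorem Exec.seq (h : F.Exec w reg mem t reg' mem') (h' : G.Exec w reg' mem' t' reg'' mem'') :
    (F.seq G).Exec w reg mem (t + t') reg'' mem'' :=
  fun P _ x hP => (h P _ _ hP.left).trans (h' P _ x hP.right)

theorem exec_loop_done {a b : ℕ} (h : ¬ reg a < reg b) :
    (F.loop a b).Exec w reg mem 1 reg mem :=
  fun _ _ _ hP => Steps.single (hP.step_test.trans (by rw [if_neg h]))

theorem Exec.loop_again {a b : ℕ} (h : reg a < reg b) (hbody : F.Exec w reg mem t reg' mem')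
    (hloop : (F.loop a b).Exec w reg' mem' t' reg'' mem'') :
    (F.loop a b).Exec w reg mem (1 + t + t') reg'' mem'' := fun P e x hP =>
  ((Steps.single (hP.step_test.trans (by rw [if_pos h]))).trans (hbody P _ _ hP.body)).trans
    (hloop P e x hP)

end Frag

/-! ### Expressions -/

/-- The word operations whose result is polynomially bounded in the operands. -/
inductive Arith
  | add | sub | mul | div | mod | shiftRight

/-- The word operation that an arithmetic operation stands for. -/
def Arith.toBinOp : Arith → BinOp
  | .add => .add
  | .sub => .sub
  | .mul => .mul
  | .div => .div
  | .mod => .mod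
  | .shiftRight => .shiftRight

theorem Arith.eval_le_mul (o : Arith) {a b x y : ℕ} (ha : a ≤ x) (hb : b ≤ y) (hx : 2 ≤ x)
    (hy : 2 ≤ y) : o.toBinOp.eval a b ≤ x * y := by
  have hxy : x ≤ x * y := Nat.le_mul_of_pos_right _ (by omega)
  cases o with
  | add => exact (Nat.add_le_add ha hb).trans (by nlinarith)
  | sub => exact (Nat.sub_le a b).trans (ha.trans hxy)
  | mul => exact Nat.mul_le_mul ha hb
  | div => exact (Nat.div_le_self a b).trans (ha.trans hxy)
  | mod => exact (Nat.mod_le a b).trans (ha.trans hxy)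
  | shiftRight => exact Nat.shiftRight_le a b |>.trans (ha.trans hxy)

/-- The values of the program variables `V`, and the memory. -/
structure State (V : Type) where
  var : V → ℕ
  mem : ℕ → ℕ

namespace State

variable {V : Type}

/-- Assignment to a variable. -/
def set [DecidableEq V] (s : State V) (v : V) (b : ℕ) : State V :=
  ⟨Function.update s.var v b, s.mem⟩

/-- Assignment to a memory cell. -/
def poke (s : State V) (a b : ℕ) : State V := ⟨s.var, Function.update s.mem a b⟩

/-- All values are at most `B`. -/
def Bdd (s : State V) (B : ℕ) : Prop := (∀ v, s.var v ≤ B) ∧ ∀ a, s.mem a ≤ B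

theorem Bdd.set [DecidableEq V] {s : State V} {B b : ℕ} {v : V} (h : s.Bdd B) (hb : b ≤ B) :
    (s.set v b).Bdd B :=
  ⟨Function.forall_update_iff _ (p := fun _ x => x ≤ B) |>.2 ⟨hb, fun v _ => h.1 v⟩, h.2⟩

theorem Bdd.poke {s : State V} {B a b : ℕ} (h : s.Bdd B) (hb : b ≤ B) : (s.poke a b).Bdd B :=
  ⟨h.1, Function.forall_update_iff _ (p := fun _ x => x ≤ B) |>.2 ⟨hb, fun a _ => h.2 a⟩⟩

end State

/-- Arithmetic expressions over the variables `V` and the memory cells. -/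
inductive Expr (V : Type)
  | var (v : V)
  | const (c : ℕ)
  | bin (o : Arith) (a b : Expr V)
  | load (a : Expr V)

namespace Expr

variable {V : Type}

instance (n : ℕ) : OfNat (Expr V) n := ⟨const n⟩
instance : Add (Expr V) := ⟨bin .add⟩
instance : Sub (Expr V) := ⟨bin .sub⟩
instance : Mul (Expr V) := ⟨bin .mul⟩
instance : Div (Expr V) := ⟨bin .div⟩
instance : Mod (Expr V) := ⟨bin .mod⟩
instance : ShiftRight (Expr V) := ⟨bin .shiftRight⟩

/-- Powers by repeated multiplication; the exponent is fixed in the program. -/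
def pow (e : Expr V) : ℕ → Expr V
  | 0 => 1
  | n + 1 => e.pow n * e

instance : Pow (Expr V) ℕ := ⟨pow⟩

/-- The value of an expression; subtraction is truncated at `0`. -/
def eval (s : State V) : Expr V → ℕ
  | var v => s.var v
  | const c => c
  | bin o a b => o.toBinOp.eval (a.eval s) (b.eval s)
  | load a => s.mem (a.eval s)

section eval

variable (s : State V) (a b : Expr V)

@[simp] theorem eval_var (v : V) : (var v).eval s = s.var v := rfl
@[simp] theorem eval_const (c : ℕ) : (const c).eval s = c := rfl
@[simp] theorem eval_load : (load a).eval s = s.mem (a.eval s) := rfl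
@[simp] theorem eval_add : (a + b).eval s = a.eval s + b.eval s := rfl
@[simp] theorem eval_mul : (a * b).eval s = a.eval s * b.eval s := rfl
@[simp] theorem eval_div : (a / b).eval s = a.eval s / b.eval s := rfl
@[simp] theorem eval_mod : (a % b).eval s = a.eval s % b.eval s := rfl
@[simp] theorem eval_shiftRight : (a >>> b).eval s = a.eval s >>> b.eval s := rfl

@[simp] theorem eval_pow (n : ℕ) : (a ^ n).eval s = a.eval s ^ n := by
  induction n with
  | zero => rfl
  | succ n ih => exact congrArg (· * a.eval s) ih

end eval

/-- The number of instructions of the compiled expression. -/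
def cost : Expr V → ℕ
  | var _ => 1
  | const _ => 1
  | bin _ a b => a.cost + b.cost + 1
  | load a => a.cost + 1

/-- An exponent such that the value of the expression is at most `B ^ weight` in states bounded by
`B`. -/
def weight : Expr V → ℕ
  | var _ => 1
  | const c => c + 1
  | bin _ a b => a.weight + b.weight
  | load a => a.weight + 1

theorem weight_pos (e : Expr V) : 0 < e.weight := by
  induction e <;> simp only [weight] <;> omega

theorem eval_le {B : ℕ} (hB : 2 ≤ B) {s : State V} (hs : s.Bdd B) (e : Expr V) :
    e.eval s ≤ B ^ e.weight := by
  have le_pow (a : Expr V) : B ≤ B ^ a.weight := Nat.le_self_pow a.weight_pos.ne' B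
  induction e with
  | var v => exact (hs.1 v).trans (le_pow (var v))
  | const c =>
    calc c ≤ B ^ c := (Nat.lt_pow_self hB).le
      _ ≤ B ^ (c + 1) := Nat.pow_le_pow_right (by omega) (Nat.le_succ c)
  | bin o a b iha ihb =>
    rw [weight, pow_add]
    exact o.eval_le_mul iha ihb (hB.trans (le_pow a)) (hB.trans (le_pow b))
  | load a _ => exact (hs.2 _).trans (le_pow (load a))

end Expr

/-! ### Register allocation -/

section registers

variable {V : Type} [Encodable V]

/-- The register of a program variable. Registers are split by their remainder modulo `3`. -/
def varReg (v : V) : ℕ := 3 * Encodable.encode v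

/-- The registers that hold intermediate results. -/
def tmpReg (d : ℕ) : ℕ := 3 * d + 1

/-- The registers reserved for a guest program. -/
def guestReg (r : ℕ) : ℕ := 3 * r + 2

theorem varReg_injective : Function.Injective (varReg : V → ℕ) := fun u v h =>
  Encodable.encode_injective (by simp only [varReg] at h; omega)

theorem tmpReg_injective : Function.Injective tmpReg := fun i j h => by
  simp only [tmpReg] at h
  omega

theorem guestReg_injective : Function.Injective guestReg := fun i j h => by
  simp only [guestReg] at h
  omega

theorem varReg_ne_tmpReg (v : V) (d : ℕ) : varReg v ≠ tmpReg d := by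
  simp only [varReg, tmpReg]
  omega

theorem guestReg_ne_tmpReg (r d : ℕ) : guestReg r ≠ tmpReg d := by
  simp only [guestReg, tmpReg]
  omega

theorem guestReg_ne_varReg (r : ℕ) (v : V) : guestReg r ≠ varReg v := by
  simp only [guestReg, varReg]
  omega

end registers

namespace Expr

variable {V : Type} [Encodable V]

/-- Code that evaluates the expression into the register `tmpReg d`. -/
def compile : Expr V → ℕ → Frag
  | var v, d => .copy (tmpReg d) (varReg v)
  | const c, d => .atom (.const (tmpReg d) c none)
  | bin o a b, d => ((a.compile d).seq (b.compile (d + 1))).seq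
      (.atom (.op o.toBinOp (tmpReg d) (tmpReg d) (tmpReg (d + 1)) none))
  | load a, d => (a.compile d).seq (.atom (.load (tmpReg d) (tmpReg d) none))

theorem exec_compile {B w : ℕ} (hB : 2 ≤ B) {s : State V} (hs : s.Bdd B) (e : Expr V)
    (hw : B ^ e.weight < 2 ^ w) (d : ℕ) (reg : ℕ → ℕ) (hreg : ∀ v, reg (varReg v) = s.var v) :
    ∃ reg', (e.compile d).Exec w reg s.mem e.cost reg' s.mem ∧ reg' (tmpReg d) = e.eval s ∧
      ∀ r, (∀ j, d ≤ j → r ≠ tmpReg j) → reg' r = reg r := by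
  have eval_lt {a : Expr V} (h : B ^ a.weight < 2 ^ w) : a.eval s < 2 ^ w :=
    (eval_le hB hs a).trans_lt h
  induction e generalizing d reg with
  | var v =>
    refine ⟨_, Frag.exec_copy (by rw [hreg]; exact eval_lt hw), ?_, fun r hr => ?_⟩
    · rw [Function.update_self, hreg, eval_var]
    · exact Function.update_of_ne (hr d le_rfl) _ _
  | const c =>
    refine ⟨_, Frag.exec_const (eval_lt hw), Function.update_self .., fun r hr => ?_⟩
    exact Function.update_of_ne (hr d le_rfl) _ _
  | bin o a b iha ihb =>
    have pow_lt {j : ℕ} (hj : j ≤ (bin o a b).weight) : B ^ j < 2 ^ w :=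
      (Nat.pow_le_pow_right (by omega) hj).trans_lt hw
    obtain ⟨reg₁, exec_a, val_a, frame_a⟩ := iha (pow_lt (by simp [weight])) d reg hreg
    obtain ⟨reg₂, exec_b, val_b, frame_b⟩ := ihb (pow_lt (by simp [weight])) (d + 1) reg₁
      fun v => by rw [frame_a _ fun j _ => varReg_ne_tmpReg v j, hreg]
    have val_a' : reg₂ (tmpReg d) = a.eval s := by
      rw [frame_b _ fun j hj => tmpReg_injective.ne (by omega), val_a]
    refine ⟨_, (exec_a.seq exec_b).seq (Frag.exec_op ?_), ?_, fun r hr => ?_⟩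
    · rw [val_a', val_b]
      exact eval_lt hw
    · rw [Function.update_self, val_a', val_b, eval]
    · rw [Function.update_of_ne (hr d le_rfl), frame_b r fun j hj => hr j (by omega),
        frame_a r hr]
  | load a iha =>
    obtain ⟨reg₁, exec_a, val_a, frame_a⟩ :=
      iha ((Nat.pow_le_pow_right (by omega) (by simp [weight])).trans_lt hw) d reg hreg
    refine ⟨_, exec_a.seq Frag.exec_load, ?_, fun r hr => ?_⟩
    · rw [Function.update_self, val_a, eval_load]
    · rw [Function.update_of_ne (hr d le_rfl), frame_a r hr]

end Expr

/-! ### Structured programs -/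

/-- Commands: the assignment of the value of an expression to a variable or to a memory cell. -/
inductive Cmd (V : Type)
  | assign (v : V) (e : Expr V)
  | store (addr e : Expr V)

/-- Statements; `loop i j st` repeats `st` while the variable `i` is smaller than the variable
`j`. -/
inductive Stmt (V : Type)
  | skip
  | cmd (c : Cmd V)
  | seq (st st' : Stmt V)
  | loop (i j : V) (st : Stmt V)

namespace Cmd

variable {V : Type}

/-- The expression whose value the command writes. -/
def value : Cmd V → Expr V
  | assign _ e => e
  | store _ e => e

/-- The number of instructions of the compiled command. -/
def cost : Cmd V → ℕ
  | assign _ e => e.cost + 1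
  | store a e => a.cost + e.cost + 1

/-- The analogue of `Expr.weight` for all the values that occur in a command. -/
def weight : Cmd V → ℕ
  | assign _ e => e.weight
  | store a e => a.weight + e.weight

/-- The effect of a command. -/
def run [DecidableEq V] (s : State V) : Cmd V → State V
  | assign v e => s.set v (e.eval s)
  | store a e => s.poke (a.eval s) (e.eval s)

/-- The command does not assign to the variable `v`. -/
def Keeps (v : V) : Cmd V → Prop
  | assign u _ => v ≠ u
  | store _ _ => True

theorem Keeps.var_run [DecidableEq V] {c : Cmd V} {v : V} (h : c.Keeps v) (s : State V) :
    (c.run s).var v = s.var v := by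
  cases c with
  | assign u e => exact Function.update_of_ne h _ _
  | store a e => rfl

theorem bdd_run [DecidableEq V] {c : Cmd V} {s : State V} {B : ℕ} (hs : s.Bdd B)
    (h : c.value.eval s ≤ B) : (c.run s).Bdd B := by
  cases c with
  | assign v e => exact hs.set h
  | store a e => exact hs.poke h

end Cmd

section compile

variable {V : Type} [Encodable V]

/-- The code of a command. -/
def Cmd.compile : Cmd V → Frag
  | assign v e => (e.compile 0).seq (.copy (varReg v) (tmpReg 0))
  | store a e => ((a.compile 0).seq (e.compile 1)).seq (.atom (.store (tmpReg 0) (tmpReg 1) none))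

/-- The code of a statement. -/
def Stmt.compile : Stmt V → Frag
  | skip => .atom (.const (tmpReg 0) 0 none)
  | cmd c => c.compile
  | seq st st' => st.compile.seq st'.compile
  | loop i j st => .loop (varReg i) (varReg j) st.compile

/-- The registers hold the values of the variables, and those of the guest are still `0`. -/
def Represents (reg : ℕ → ℕ) (s : State V) : Prop :=
  (∀ v, reg (varReg v) = s.var v) ∧ ∀ r, reg (guestReg r) = 0

theorem Represents.of_frame {reg reg' : ℕ → ℕ} {s : State V} (h : Represents reg s) {d : ℕ}
    (frame : ∀ r, (∀ j, d ≤ j → r ≠ tmpReg j) → reg' r = reg r) : Represents reg' s :=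
  ⟨fun v => (frame _ fun j _ => varReg_ne_tmpReg v j).trans (h.1 v),
    fun r => (frame _ fun j _ => guestReg_ne_tmpReg r j).trans (h.2 r)⟩

theorem Represents.update [DecidableEq V] {reg : ℕ → ℕ} {s : State V} (h : Represents reg s)
    (v : V) (b : ℕ) : Represents (Function.update reg (varReg v) b) (s.set v b) := by
  refine ⟨fun u => ?_, fun r => ?_⟩
  · exact (Function.update_apply_of_injective (g := reg) varReg_injective v b u).trans
      (congrFun (congrArg (Function.update · v b) (funext h.1)) u)
  · rw [Function.update_of_ne (guestReg_ne_varReg r v), h.2]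

variable [DecidableEq V]

theorem Cmd.exec_compile {B w : ℕ} (hB : 2 ≤ B) {s : State V} (hs : s.Bdd B) (c : Cmd V)
    (hw : B ^ c.weight < 2 ^ w) {reg : ℕ → ℕ} (hreg : Represents reg s) :
    ∃ reg', Represents reg' (c.run s) ∧ c.compile.Exec w reg s.mem c.cost reg' (c.run s).mem := by
  cases c with
  | assign v e =>
    obtain ⟨reg₁, exec_e, val_e, frame_e⟩ := e.exec_compile hB hs hw 0 reg hreg.1
    have exec_copy := Frag.exec_copy (reg := reg₁) (mem := s.mem) (d := varReg v)
      (val_e ▸ (e.eval_le hB hs).trans_lt hw)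
    rw [val_e] at exec_copy
    exact ⟨_, (hreg.of_frame frame_e).update v _, exec_e.seq exec_copy⟩
  | store a e =>
    have pow_lt {j : ℕ} (hj : j ≤ (store a e).weight) : B ^ j < 2 ^ w :=
      (Nat.pow_le_pow_right (by omega) hj).trans_lt hw
    obtain ⟨reg₁, exec_a, val_a, frame_a⟩ :=
      a.exec_compile hB hs (pow_lt (by simp [weight])) 0 reg hreg.1
    have hreg₁ := hreg.of_frame frame_a
    obtain ⟨reg₂, exec_e, val_e, frame_e⟩ :=
      e.exec_compile hB hs (pow_lt (by simp [weight])) 1 reg₁ hreg₁.1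
    have val_a' : reg₂ (tmpReg 0) = a.eval s := by
      rw [frame_e _ fun j hj => tmpReg_injective.ne (by omega), val_a]
    have exec_store := Frag.exec_store (w := w) (reg := reg₂) (mem := s.mem) (a := tmpReg 0)
      (b := tmpReg 1)
    rw [val_a', val_e] at exec_store
    exact ⟨reg₂, hreg₁.of_frame frame_e, (exec_a.seq exec_e).seq exec_store⟩

end compile

namespace Stmt

variable {V : Type}

/-- The number of instructions in one pass through the compiled statement, with two instructions
for the tests of each loop: the first and the last one. -/
def cost : Stmt V → ℕ
  | skip => 1
  | cmd c => c.cost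
  | seq st st' => st.cost + st'.cost
  | loop _ _ st => st.cost + 2

/-- The analogue of `Expr.weight` for all the values that occur in a statement. -/
def weight : Stmt V → ℕ
  | skip => 0
  | cmd c => c.weight
  | seq st st' => st.weight + st'.weight
  | loop _ _ st => st.weight

/-- A sequence of commands. -/
def block (cs : List (Cmd V)) : Stmt V :=
  cs.foldr (fun c st => seq (cmd c) st) skip

variable [DecidableEq V]

/-- `Run B st s t s'`: the statement leads from `s` to `s'` in `t` machine steps, along states
bounded by `B`. -/
inductive Run (B : ℕ) : Stmt V → State V → ℕ → State V → Prop
  | skip {s : State V} : Run B skip s 1 s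
  | cmd {c : Cmd V} {s : State V} (h : s.Bdd B) : Run B (cmd c) s c.cost (c.run s)
  | seq {st st' : Stmt V} {s s' s'' : State V} {t t' : ℕ} (h : Run B st s t s')
      (h' : Run B st' s' t' s'') : Run B (seq st st') s (t + t') s''
  | loop_done {i j : V} {st : Stmt V} {s : State V} (h : ¬ s.var i < s.var j) :
      Run B (loop i j st) s 1 s
  | loop_again {i j : V} {st : Stmt V} {s s' s'' : State V} {t t' : ℕ} (h : s.var i < s.var j)
      (hbody : Run B st s t s') (hloop : Run B (loop i j st) s' t' s'') :
      Run B (loop i j st) s (1 + t + t') s''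

theorem Run.exec [Encodable V] {B w : ℕ} (hB : 2 ≤ B) {st : Stmt V} {s s' : State V} {t : ℕ}
    (h : st.Run B s t s') (hw : B ^ st.weight < 2 ^ w) {reg : ℕ → ℕ} (hreg : Represents reg s) :
    ∃ reg', Represents reg' s' ∧ st.compile.Exec w reg s.mem t reg' s'.mem := by
  induction h generalizing reg with
  | skip =>
    refine ⟨_, hreg.of_frame (d := 0) fun r hr => ?_, Frag.exec_const (Nat.two_pow_pos w)⟩
    exact Function.update_of_ne (hr 0 le_rfl) _ _
  | cmd hs => exact Cmd.exec_compile hB hs _ hw hreg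
  | @seq st st' s s' s'' t t' _ _ ih ih' =>
    have pow_lt {j : ℕ} (hj : j ≤ (Stmt.seq st st').weight) : B ^ j < 2 ^ w :=
      (Nat.pow_le_pow_right (by omega) hj).trans_lt hw
    obtain ⟨reg₁, hreg₁, exec₁⟩ := ih (pow_lt (by simp [weight])) hreg
    obtain ⟨reg₂, hreg₂, exec₂⟩ := ih' (pow_lt (by simp [weight])) hreg₁
    exact ⟨reg₂, hreg₂, exec₁.seq exec₂⟩
  | loop_done hlt =>
    exact ⟨reg, hreg, Frag.exec_loop_done (by rwa [hreg.1, hreg.1])⟩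
  | loop_again hlt _ _ ih ih' =>
    obtain ⟨reg₁, hreg₁, exec₁⟩ := ih hw hreg
    obtain ⟨reg₂, hreg₂, exec₂⟩ := ih' hw hreg₁
    exact ⟨reg₂, hreg₂, Frag.Exec.loop_again (by rwa [hreg.1, hreg.1]) exec₁ exec₂⟩

/-- `Wp B D st Q s`: from `s`, the statement runs along states bounded by `B` to a state with `Q`,
in at most `st.cost * D` machine steps. -/
def Wp (B D : ℕ) (st : Stmt V) (Q : State V → Prop) (s : State V) : Prop :=
  ∃ t s', st.Run B s t s' ∧ t ≤ st.cost * D ∧ s'.Bdd B ∧ Q s'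

/-- The weakest condition under which the commands, one after the other, write only values that are
at most `B` and lead to a state with `Q`. -/
def wpBlock (B : ℕ) (Q : State V → Prop) : List (Cmd V) → State V → Prop
  | [], s => Q s
  | c :: cs, s => c.value.eval s ≤ B ∧ wpBlock B Q cs (c.run s)

section wpBlock

variable {B : ℕ} {Q Q' : State V → Prop} {s : State V} {cs cs' : List (Cmd V)}

theorem wpBlock_append : wpBlock B Q (cs ++ cs') s ↔ wpBlock B (wpBlock B Q cs') cs s := by
  induction cs generalizing s with
  | nil => rfl
  | cons c cs ih => exact and_congr_right fun _ => ih

theorem wpBlock.mono (h : wpBlock B Q cs s) (hQ : ∀ s', Q s' → Q' s') : wpBlock B Q' cs s := by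
  induction cs generalizing s with
  | nil => exact hQ s h
  | cons c cs ih => exact ⟨h.1, ih h.2⟩

theorem wpBlock.and_keeps {v : V} (h : wpBlock B Q cs s) (hv : ∀ c ∈ cs, c.Keeps v) :
    wpBlock B (fun s' => Q s' ∧ s'.var v = s.var v) cs s := by
  induction cs generalizing s with
  | nil => exact ⟨h, rfl⟩
  | cons c cs ih =>
    rw [List.forall_mem_cons] at hv
    refine ⟨h.1, (ih h.2 hv.2).mono fun s' hs' => ?_⟩
    rwa [hv.1.var_run] at hs'

end wpBlock

section Wp

variable {B D : ℕ} {st st' : Stmt V} {Q Q' : State V → Prop} {s : State V}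

theorem Wp.mono (h : Wp B D st Q s) (hQ : ∀ s', Q s' → Q' s') : Wp B D st Q' s := by
  obtain ⟨t, s', run, ht, hs', hQs'⟩ := h
  exact ⟨t, s', run, ht, hs', hQ _ hQs'⟩

theorem wp_block {cs : List (Cmd V)} (hD : 1 ≤ D) (hs : s.Bdd B) (h : wpBlock B Q cs s) :
    Wp B D (block cs) Q s := by
  induction cs generalizing s with
  | nil => exact ⟨1, s, .skip, by simpa [block, cost] using hD, hs, h⟩
  | cons c cs ih =>
    obtain ⟨t, s', run, ht, hs', hQ⟩ := ih (Cmd.bdd_run hs h.1) h.2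
    refine ⟨_, s', .seq (.cmd hs) run, ?_, hs', hQ⟩
    calc c.cost + t ≤ c.cost * D + (block cs).cost * D :=
          Nat.add_le_add (Nat.le_mul_of_pos_right _ hD) ht
      _ = (block (c :: cs)).cost * D := (Nat.add_mul ..).symm

theorem wp_seq (h : Wp B D st (fun s' => s'.Bdd B → Wp B D st' Q s') s) :
    Wp B D (seq st st') Q s := by
  obtain ⟨t, s', run, ht, hs', hQ⟩ := h
  obtain ⟨t', s'', run', ht', hs'', hQ'⟩ := hQ hs'
  exact ⟨_, _, run.seq run', (Nat.add_le_add ht ht').trans_eq (Nat.add_mul ..).symm, hs'', hQ'⟩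

theorem wp_loop {i j : V} {n : ℕ} (hD : 1 ≤ D) (hn : n ≤ D) (I : ℕ → State V → Prop)
    (hs : s.Bdd B) (init : I 0 s) (test : ∀ l ≤ n, ∀ s, I l s → (s.var i < s.var j ↔ l < n))
    (body : ∀ l < n, ∀ s, s.Bdd B → I l s → Wp B 1 st (I (l + 1)) s) :
    Wp B D (loop i j st) (I n) s := by
  have rounds (d : ℕ) : ∀ l s, l + d = n → s.Bdd B → I l s → ∃ t s',
      (loop i j st).Run B s t s' ∧ t ≤ d * (st.cost + 1) + 1 ∧ s'.Bdd B ∧ I n s' := by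
    induction d with
    | zero =>
      rintro l s rfl hs hI
      refine ⟨1, s, .loop_done ?_, by omega, hs, hI⟩
      simp [test l le_rfl s hI]
    | succ d ih =>
      intro l s hl hs hI
      obtain ⟨t, s', run, ht, hs', hI'⟩ := body l (by omega) s hs hI
      obtain ⟨t', s'', run', ht', hs'', hI''⟩ := ih (l + 1) s' (by omega) hs' hI'
      refine ⟨_, s'', .loop_again ((test l (by omega) s hI).2 (by omega)) run run', ?_, hs'', hI''⟩
      rw [Nat.mul_one] at ht
      linarith [Nat.succ_mul d (st.cost + 1)]
  obtain ⟨t, s', run, ht, hs', hI⟩ := rounds n 0 s (Nat.zero_add n) hs init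
  refine ⟨t, s', run, ht.trans ?_, hs', hI⟩
  calc n * (st.cost + 1) + 1 ≤ D * (st.cost + 1) + D := by gcongr
    _ = (loop i j st).cost * D := by rw [cost]; ring

end Wp

/-- `for i = 0, …, e - 1`, where the value of `e` is kept in the variable `limit`. -/
def forTo (i limit : V) (e : Expr V) (body : List (Cmd V)) : Stmt V :=
  seq (block [.assign i 0, .assign limit e])
    (loop i limit (block (body ++ [.assign i (.var i + 1)])))

theorem wp_forTo {B D n : ℕ} {i limit : V} {e : Expr V} {body : List (Cmd V)} {s : State V}
    (hlimit : limit ≠ i) (keeps_i : ∀ c ∈ body, c.Keeps i) (keeps_limit : ∀ c ∈ body, c.Keeps limit)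
    (hD : 1 ≤ D) (hn : n ≤ D) (hnB : n ≤ B) (hs : s.Bdd B) (he : e.eval (s.set i 0) = n)
    (I : ℕ → State V → Prop) (init : I 0 s)
    (stable : ∀ l s b, I l s → I l (s.set i b) ∧ I l (s.set limit b))
    (step : ∀ l < n, ∀ s, s.var i = l → I l s → wpBlock B (I (l + 1)) body s) :
    Wp B D (forTo i limit e body) (I n) s := by
  refine wp_seq (wp_block hD hs ⟨Nat.zero_le B, he.trans_le hnB, fun hs' => ?_⟩)
  refine (wp_loop hD hn (fun l s => s.var i = l ∧ s.var limit = n ∧ I l s) hs' ⟨?_, ?_, ?_⟩ ?_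
    ?_).mono fun _ h => h.2.2
  · exact (Function.update_of_ne hlimit.symm _ _).trans (Function.update_self ..)
  · exact (Function.update_self ..).trans he
  · exact (stable _ _ _ (stable _ _ _ init).1).2
  · rintro l - s ⟨hi, hl, -⟩
    rw [hi, hl]
  · rintro l hl s hs ⟨hi, hlim, hI⟩
    refine wp_block le_rfl hs (wpBlock_append.2 ?_)
    refine (((step l hl s hi hI).and_keeps keeps_i).and_keeps keeps_limit).mono ?_
    rintro s' ⟨⟨hI', hi'⟩, hlim'⟩
    refine ⟨?_, ?_, ?_, (stable _ _ _ hI').1⟩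
    · change s'.var i + 1 ≤ B
      omega
    · exact (Function.update_self ..).trans (congrArg (· + 1) (hi'.trans hi))
    · exact (Function.update_of_ne hlimit _ _).trans (hlim'.trans hlim)

end Stmt

/-! ### Output -/

/-- The list `l` occupies the memory cells from `S` on, and the cells behind it hold `0`. -/
def Holds (mem : ℕ → ℕ) (S : ℕ) (l : List ℕ) : Prop := ∀ i, mem (S + i) = l.getD i 0

theorem Holds.snoc {mem : ℕ → ℕ} {S : ℕ} {l : List ℕ} (h : Holds mem S l) (b : ℕ) :
    Holds (Function.update mem (S + l.length) b) S (l ++ [b]) := fun i => by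
  rcases lt_trichotomy i l.length with hlt | rfl | hgt
  · rw [Function.update_of_ne (by omega), h i, List.getD_append _ _ _ _ hlt]
  · simp
  · rw [Function.update_of_ne (by omega), h i, List.getD_eq_default _ _ hgt.le,
      List.getD_eq_default _ _ (by simpa using hgt)]

/-- The value of the expression depends on variables other than `v` only. -/
def Expr.avoids {V : Type} [DecidableEq V] (v : V) : Expr V → Bool
  | var u => u ≠ v
  | const _ => true
  | bin _ a b => a.avoids v && b.avoids v
  | load _ => false

theorem Expr.eval_congr {V : Type} [DecidableEq V] {v : V} {e : Expr V} (he : e.avoids v)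
    {s s' : State V} (h : ∀ u ≠ v, s'.var u = s.var u) : e.eval s' = e.eval s := by
  induction e with
  | var u => exact h u (of_decide_eq_true he)
  | const => rfl
  | bin o a b iha ihb =>
    rw [avoids, Bool.and_eq_true] at he
    rw [eval, eval, iha he.1, ihb he.2]
  | load => exact absurd he Bool.false_ne_true

/-- Stores the values of the expressions in consecutive cells, the first of which is given by the
variable `ptr`, and advances `ptr` behind them. -/
def emit {V : Type} (ptr : V) (es : List (Expr V)) : List (Cmd V) :=
  es.flatMap fun e => [.store (.var ptr) e, .assign ptr (.var ptr + 1)]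

namespace State

variable {V : Type}

/-- The states agree except possibly in the variable `ptr` and in the memory cells from `S` on. -/
def AgreeBelow (ptr : V) (S : ℕ) (s s' : State V) : Prop :=
  (∀ v, v ≠ ptr → s'.var v = s.var v) ∧ ∀ a < S, s'.mem a = s.mem a

/-- The list `l` has been written from the memory cell `S` on, and `ptr` points behind it. -/
def HasOutput (ptr : V) (S : ℕ) (l : List ℕ) (s : State V) : Prop :=
  s.var ptr = S + l.length ∧ Holds s.mem S l

variable {ptr : V} {S : ℕ}

theorem AgreeBelow.refl (s : State V) : AgreeBelow ptr S s s :=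
  ⟨fun _ _ => rfl, fun _ _ => rfl⟩

theorem AgreeBelow.trans {s s' s'' : State V} (h : AgreeBelow ptr S s s')
    (h' : AgreeBelow ptr S s' s'') : AgreeBelow ptr S s s'' :=
  ⟨fun v hv => (h'.1 v hv).trans (h.1 v hv), fun a ha => (h'.2 a ha).trans (h.2 a ha)⟩

variable [DecidableEq V]

theorem agreeBelow_write (s : State V) {a : ℕ} (ha : S ≤ a) (b c : ℕ) :
    AgreeBelow ptr S s ((s.poke a b).set ptr c) :=
  ⟨fun _ hv => Function.update_of_ne hv _ _, fun _ ha' => Function.update_of_ne (by omega) _ _⟩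

theorem HasOutput.write {s : State V} {l : List ℕ} (h : HasOutput ptr S l s) (b : ℕ) :
    HasOutput ptr S (l ++ [b]) ((s.poke (s.var ptr) b).set ptr (s.var ptr + 1)) := by
  refine ⟨(Function.update_self ..).trans ?_, ?_⟩
  · rw [h.1, List.length_append, List.length_singleton, Nat.add_assoc]
  · rw [h.1]
    exact h.2.snoc b

end State

theorem Stmt.wpBlock_emit {V : Type} [DecidableEq V] {B S : ℕ} {ptr : V} {es : List (Expr V)}
    {l : List ℕ} {s : State V} (hes : es.all (Expr.avoids ptr)) (hB : ∀ e ∈ es, e.eval s ≤ B)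
    (hlen : S + l.length + es.length ≤ B) (hout : s.HasOutput ptr S l) :
    wpBlock B
      (fun s' => State.AgreeBelow ptr S s s' ∧ s'.HasOutput ptr S (l ++ es.map (Expr.eval s)))
      (emit ptr es) s := by
  induction es generalizing s l with
  | nil => exact ⟨.refl s, by rwa [List.map_nil, List.append_nil]⟩
  | cons e es ih =>
    rw [List.length_cons] at hlen
    rw [List.all_cons, Bool.and_eq_true] at hes
    rw [List.forall_mem_cons] at hB
    have hwrite := State.agreeBelow_write (ptr := ptr) (S := S) s (a := s.var ptr)
      (by rw [hout.1]; omega) (e.eval s) (s.var ptr + 1)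
    have eval_eq (e') (he' : e' ∈ es) :=
      Expr.eval_congr (List.all_eq_true.1 hes.2 e' he') hwrite.1
    refine ⟨hB.1, ?_, (ih (l := l ++ [e.eval s]) hes.2 ?_ ?_ (hout.write _)).mono ?_⟩
    · change s.var ptr + 1 ≤ B
      rw [hout.1]
      omega
    · exact fun e' he' => (eval_eq e' he').trans_le (hB.2 e' he')
    · rw [List.length_append, List.length_singleton]
      omega
    · rintro s' ⟨hs', hout'⟩
      refine ⟨hwrite.trans hs', ?_⟩
      rwa [List.append_assoc, List.map_congr_left eval_eq] at hout'

end WordRAM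

namespace WordRAM

/-! ### Reductions -/

section link

variable {V : Type} [Encodable V]

/-- First the statement `st`, and then the guest program `P`, whose memory is shifted by the value
of the variable `v`, and whose registers are renamed by `guestReg`. At the label `(l, true)` the
shifted address for the memory access at `l` is in `tmpReg 0`. -/
def link (st : Stmt V) (v : V) (P : Program) : Program where
  Label := st.compile.Label ⊕ P.Label × Bool
  finite := by
    have := st.compile.finite
    have := P.finite
    infer_instance
  start := .inl st.compile.start
  instr
    | .inl l => (st.compile.instr l).map fun o => o.elim (.inr (P.start, false)) .inl
    | .inr (l, shifted) =>
      match P.instr l, shifted with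
      | .halt b, _ => .halt b
      | .const dst c next, _ => .const (guestReg dst) c (.inr (next, false))
      | .op o dst a b next, _ =>
        .op o (guestReg dst) (guestReg a) (guestReg b) (.inr (next, false))
      | .load _ addr _, false => .op .add (tmpReg 0) (varReg v) (guestReg addr) (.inr (l, true))
      | .load dst _ next, true => .load (guestReg dst) (tmpReg 0) (.inr (next, false))
      | .store addr _ _, false => .op .add (tmpReg 0) (varReg v) (guestReg addr) (.inr (l, true))
      | .store _ src next, true => .store (tmpReg 0) (guestReg src) (.inr (next, false))
      | .branchLt a b yes no, _ =>
        .branchLt (guestReg a) (guestReg b) (.inr (yes, false)) (.inr (no, false))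
      | .branchEq a b yes no, _ =>
        .branchEq (guestReg a) (guestReg b) (.inr (yes, false)) (.inr (no, false))

/-- The registers `reg'` and the memory `mem'` of the linked program contain the registers `reg`
and the memory `mem` of the guest. -/
structure Hosts (v : V) (S : ℕ) (reg mem reg' mem' : ℕ → ℕ) : Prop where
  guest : ∀ r, reg' (guestReg r) = reg r
  base : reg' (varReg v) = S
  mem : ∀ a, mem' (S + a) = mem a

namespace Hosts

variable {v : V} {S : ℕ} {reg mem reg' mem' : ℕ → ℕ}

theorem update_reg (h : Hosts v S reg mem reg' mem') (r b : ℕ) :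
    Hosts v S (Function.update reg r b) mem (Function.update reg' (guestReg r) b) mem' where
  guest i := (Function.update_apply_of_injective (g := reg') guestReg_injective r b i).trans
    (congrFun (congrArg (Function.update · r b) (funext h.guest)) i)
  base := (Function.update_of_ne (guestReg_ne_varReg r v).symm _ _).trans h.base
  mem := h.mem

theorem update_tmp (h : Hosts v S reg mem reg' mem') (d b : ℕ) :
    Hosts v S reg mem (Function.update reg' (tmpReg d) b) mem' where
  guest r := (Function.update_of_ne (guestReg_ne_tmpReg r d) _ _).trans (h.guest r)
  base := (Function.update_of_ne (varReg_ne_tmpReg v d) _ _).trans h.base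
  mem := h.mem

theorem update_mem (h : Hosts v S reg mem reg' mem') (a b : ℕ) :
    Hosts v S reg (Function.update mem a b) reg' (Function.update mem' (S + a) b) where
  guest := h.guest
  base := h.base
  mem i := (Function.update_apply_of_injective (g := mem') (add_right_injective S) a b i).trans
    (congrFun (congrArg (Function.update · a b) (funext h.mem)) i)

end Hosts

variable {st : Stmt V} {v : V} {P : Program} {S w w' X : ℕ} {reg mem reg' mem' : ℕ → ℕ}

theorem step_link_shift {l : P.Label} {addr : ℕ} (h : Hosts v S reg mem reg' mem')
    (hi : (link st v P).instr (.inr (l, false)) =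
      .op .add (tmpReg 0) (varReg v) (guestReg addr) (.inr (l, true)))
    (hw : S + reg addr < 2 ^ w') :
    step (link st v P) w' ⟨.inr (l, false), reg', mem'⟩ =
      some ⟨.inr (l, true), Function.update reg' (tmpReg 0) (S + reg addr), mem'⟩ := by
  simp only [step, hi, BinOp.eval, h.guest, h.base, if_pos hw]

/-- Registers and memory are at most `X`. -/
def Config.Bdd (c : Config P) (X : ℕ) : Prop :=
  (∀ r, c.reg r ≤ X) ∧ ∀ a, c.mem a ≤ X

theorem Config.Bdd.step {c d : Config P} (hX : 2 ^ w ≤ X) (hc : c.Bdd X)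
    (h : step P w c = some d) : d.Bdd X := by
  have update_le {f : ℕ → ℕ} (hf : ∀ i, f i ≤ X) {b : ℕ} (hb : b ≤ X) (a i : ℕ) :
      Function.update f a b i ≤ X :=
    Function.forall_update_iff f (p := fun _ y => y ≤ X) |>.2 ⟨hb, fun i _ => hf i⟩ i
  unfold WordRAM.step at h
  split at h
  case h_1 => cases h
  case h_2 =>
    split at h <;> cases h
    exact ⟨update_le hc.1 (by omega) _, hc.2⟩
  case h_3 =>
    split at h <;> cases h
    exact ⟨update_le hc.1 (by omega) _, hc.2⟩
  case h_4 =>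
    cases h
    exact ⟨update_le hc.1 (hc.2 _) _, hc.2⟩
  case h_5 =>
    cases h
    exact ⟨hc.1, update_le hc.2 (hc.1 _) _⟩
  all_goals
    cases h
    exact hc

theorem steps_link {c d : Config P} (hw : w ≤ w') (hS : X + S < 2 ^ w') (hc : c.Bdd X)
    (h : Hosts v S c.reg c.mem reg' mem') (hstep : step P w c = some d) :
    ∃ t ≤ 2, ∃ reg'' mem'', Hosts v S d.reg d.mem reg'' mem'' ∧
      Steps (link st v P) w' t ⟨.inr (c.label, false), reg', mem'⟩
        ⟨.inr (d.label, false), reg'', mem''⟩ := by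
  have word {b : ℕ} (hb : b < 2 ^ w) : b < 2 ^ w' :=
    hb.trans_le (Nat.pow_le_pow_right two_pos hw)
  have shift (addr : ℕ) : S + c.reg addr < 2 ^ w' := by
    have := hc.1 addr
    omega
  unfold step at hstep
  cases hi : P.instr c.label with simp only [hi] at hstep
  | halt b => cases hstep
  | const dst b next =>
    split at hstep <;> cases hstep
    refine ⟨1, one_le_two, _, _, h.update_reg dst b, Steps.single ?_⟩
    simp only [step, link, hi]
    rw [if_pos (word ‹_›)]
  | op o dst a b next =>
    split at hstep <;> cases hstep
    refine ⟨1, one_le_two, _, _, h.update_reg dst _, Steps.single ?_⟩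
    simp only [step, link, hi, h.guest]
    rw [if_pos (word ‹_›)]
  | load dst addr next =>
    cases hstep
    have hshift := step_link_shift (st := st) (l := c.label) h (by simp only [link, hi])
      (shift addr)
    have hosts := h.update_tmp 0 (S + c.reg addr)
    refine ⟨2, le_rfl, _, _, hosts.update_reg dst _, _, hshift, Steps.single ?_⟩
    simp only [step, link, hi, Function.update_self, h.mem]
  | store addr src next =>
    cases hstep
    have hshift := step_link_shift (st := st) (l := c.label) h (by simp only [link, hi])
      (shift addr)
    have hosts := h.update_tmp 0 (S + c.reg addr)
    refine ⟨2, le_rfl, _, _, hosts.update_mem _ _, _, hshift, Steps.single ?_⟩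
    simp only [step, link, hi, Function.update_self, hosts.guest]
  | branchLt a b yes no | branchEq a b yes no =>
    cases hstep
    refine ⟨1, one_le_two, _, _, h, Steps.single ?_⟩
    simp only [step, link, hi, h.guest]
    split <;> rfl

theorem HaltsIn.link {c : Config P} {t : ℕ} {b : Bool} (hw : w ≤ w') (hX : 2 ^ w ≤ X)
    (hS : X + S < 2 ^ w') (h : HaltsIn P w c t b) (hc : c.Bdd X)
    (hosts : Hosts v S c.reg c.mem reg' mem') :
    ∃ t' ≤ 2 * t, HaltsIn (link st v P) w' ⟨.inr (c.label, false), reg', mem'⟩ t' b := by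
  induction h generalizing reg' mem' with
  | halt h => exact ⟨1, one_le_two, .halt (by simp only [WordRAM.link, h])⟩
  | step hstep _ ih =>
    obtain ⟨t₁, ht₁, reg'', mem'', hosts', steps⟩ := steps_link (st := st) hw hS hc hosts hstep
    obtain ⟨t₂, ht₂, halts⟩ := ih (hc.step hX hstep) hosts'
    exact ⟨t₁ + t₂, by omega, steps.haltsIn halts⟩

/-- The state in which a statement starts on a given input. -/
def initState (V : Type) (input : List ℕ) : State V := ⟨fun _ => 0, fun i => input.getD i 0⟩

/-- The list `l` has been prepared as the input of another program, from the cell `v` on. -/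
def HasInput (v : V) (l : List ℕ) (s : State V) : Prop := Holds s.mem (s.var v) l

theorem HaltsIn.link_init [DecidableEq V] {B D t : ℕ} {b : Bool} {input input' : List ℕ}
    (h : HaltsIn P w (init P input') t b) (hB : 2 ≤ B) (hst : B ^ st.weight < 2 ^ w')
    (hw : w ≤ w') (hBX : 2 ^ w + B + B < 2 ^ w')
    (hwp : st.Wp B D (HasInput v input') (initState V input)) :
    ∃ t' ≤ st.cost * D + 2 * t,
      HaltsIn (WordRAM.link st v P) w' (init (WordRAM.link st v P) input) t' b := by
  obtain ⟨t₁, s, run, ht₁, hs, hinput⟩ := hwp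
  obtain ⟨reg, hreg, exec⟩ := run.exec hB hst (reg := fun _ => 0) ⟨fun _ => rfl, fun _ => rfl⟩
  have steps := exec (WordRAM.link st v P) .inl (.inr (P.start, false)) fun l => rfl
  have hbase : 2 ^ w + B + s.var v < 2 ^ w' := (Nat.add_le_add_left (hs.1 v) _).trans_lt hBX
  have bdd : (init P input').Bdd (2 ^ w + B) :=
    ⟨fun _ => Nat.zero_le _,
      fun a => (hinput a).symm.trans_le ((hs.2 _).trans (Nat.le_add_left B _))⟩
  obtain ⟨t₂, ht₂, halts⟩ := HaltsIn.link (st := st) hw (Nat.le_add_right _ B) hbase h bdd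
    ⟨hreg.2, hreg.1 v, hinput⟩
  exact ⟨t₁ + t₂, by omega, steps.haltsIn halts⟩

end link

theorem exists_word_length (b c e : ℕ) : ∃ c', ∀ B len len' : ℕ,
    B ≤ 2 ^ (b * (Nat.log 2 len + 1)) → len' ≤ B →
    c * (Nat.log 2 len' + 1) ≤ c' * (Nat.log 2 len + 1) ∧ B ^ e < 2 ^ (c' * (Nat.log 2 len + 1)) ∧
      2 ^ (c * (Nat.log 2 len' + 1)) + B + B < 2 ^ (c' * (Nat.log 2 len + 1)) := by
  refine ⟨c * (b + 1) + b + b * e + 2, fun B len len' hB hlen => ?_⟩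
  set l := Nat.log 2 len + 1 with hl
  have hl1 : 1 ≤ l := Nat.le_add_left 1 _
  have hlog : Nat.log 2 len' ≤ b * l :=
    (Nat.log_mono_right (hlen.trans hB)).trans_eq (Nat.log_pow one_lt_two _)
  have hw : c * (Nat.log 2 len' + 1) ≤ c * (b + 1) * l := by
    rw [Nat.mul_assoc]
    exact Nat.mul_le_mul_left c (by linarith)
  have pow_le {i j : ℕ} (h : i ≤ j) : 2 ^ i ≤ 2 ^ j := Nat.pow_le_pow_right two_pos h
  refine ⟨hw.trans (Nat.mul_le_mul_right l (by omega)), ?_, ?_⟩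
  · calc B ^ e ≤ (2 ^ (b * l)) ^ e := Nat.pow_le_pow_left hB e
      _ = 2 ^ (b * e * l) := by rw [← pow_mul, mul_right_comm]
      _ < 2 ^ ((c * (b + 1) + b + b * e + 2) * l) :=
        Nat.pow_lt_pow_right one_lt_two (Nat.mul_lt_mul_of_pos_right (by omega) hl1)
  · have hp₁ : 2 ^ (c * (Nat.log 2 len' + 1)) ≤ 2 ^ (c * (b + 1) * l + b * l) :=
      pow_le (hw.trans (Nat.le_add_right _ _))
    have hp₂ : B ≤ 2 ^ (c * (b + 1) * l + b * l) := hB.trans (pow_le (Nat.le_add_left _ _))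
    calc 2 ^ (c * (Nat.log 2 len' + 1)) + B + B
        < 2 ^ (c * (b + 1) * l + b * l) * 2 ^ 2 := by
          have := Nat.two_pow_pos (c * (b + 1) * l + b * l)
          linarith
      _ = 2 ^ (c * (b + 1) * l + b * l + 2) := (pow_add _ _ _).symm
      _ ≤ 2 ^ ((c * (b + 1) + b + b * e + 2) * l) := pow_le (by nlinarith)

theorem DecidableInTime.of_reduction {V I J : Type} [DecidableEq V] [Encodable V]
    {enc : I → List ℕ} {yes : I → Prop} {len : I → ℕ} {T : I → ℝ}
    {enc' : J → List ℕ} {yes' : J → Prop} {len' : J → ℕ} {T' : J → ℝ}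
    (h : DecidableInTime enc' yes' len' T') (f : I → J) (hyes : ∀ x, yes' (f x) ↔ yes x)
    (st : Stmt V) (v : V) (B D : I → ℕ) (hB : ∀ x, 2 ≤ B x)
    (hst : ∀ x, st.Wp (B x) (D x) (HasInput v (enc' (f x))) (initState V (enc x)))
    (b : ℕ) (hword : ∀ x, B x ≤ 2 ^ (b * (Nat.log 2 (len x) + 1)))
    (hlen : ∀ x, len' (f x) ≤ B x) (A A' : ℝ) (hD : ∀ x, (D x : ℝ) ≤ A * T x)
    (hT : ∀ x, |T' (f x)| ≤ A' * T x) : DecidableInTime enc yes len T := by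
  obtain ⟨P, c, C, hP⟩ := h
  obtain ⟨c', hc'⟩ := exists_word_length b c st.weight
  refine ⟨link st v P, c', st.cost * A + 2 * (|C| * A'), fun x => ?_⟩
  obtain ⟨t, ans, halts, hans, ht⟩ := hP (f x)
  obtain ⟨hw, hweight, hX⟩ := hc' (B x) (len x) (len' (f x)) (hword x) (hlen x)
  obtain ⟨t', ht', halts'⟩ := halts.link_init (hB x) hweight hw hX (hst x)
  refine ⟨t', ans, halts', hans.trans (hyes x), ?_⟩
  have ht_le : (t : ℝ) ≤ |C| * (A' * T x) :=
    calc (t : ℝ) ≤ C * T' (f x) := ht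
      _ ≤ |C| * |T' (f x)| := (le_abs_self _).trans_eq (abs_mul _ _)
      _ ≤ |C| * (A' * T x) := by gcongr; exact hT x
  calc (t' : ℝ) ≤ st.cost * D x + 2 * t := by exact_mod_cast ht'
    _ ≤ st.cost * (A * T x) + 2 * (|C| * (A' * T x)) := by gcongr; exact hD x
    _ = (st.cost * A + 2 * (|C| * A')) * T x := by ring

end WordRAM

/-! ### Colour coding -/

namespace ColourCoding

theorem exists_digits {b n : ℕ} (f : Fin n → Fin b) :
    ∃ g < b ^ n, ∀ i : Fin n, g / b ^ (i : ℕ) % b = f i := by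
  refine ⟨finFunctionFinEquiv f, (finFunctionFinEquiv f).isLt, fun i => ?_⟩
  rw [← finFunctionFinEquiv_symm_apply_val, Equiv.symm_apply_apply]

/-- The number whose binary digits are the bits of `v` at `K` positions, which are the digits of
`p` in base `L`. -/
def pattern (L K p v : ℕ) : ℕ :=
  ∑ t : Fin K, (v >>> (p / L ^ (t : ℕ) % L) % 2) * 2 ^ (t : ℕ)

theorem pattern_eq (L K p v : ℕ) :
    pattern L K p v = finFunctionFinEquiv fun t : Fin K =>
      (⟨v >>> (p / L ^ (t : ℕ) % L) % 2, Nat.mod_lt _ two_pos⟩ : Fin 2) :=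
  rfl

theorem pattern_lt (L K p v : ℕ) : pattern L K p v < 2 ^ K :=
  (pattern_eq L K p v).trans_lt (Fin.isLt _)

theorem bit_eq_of_pattern_eq {L K p v v' : ℕ} (h : pattern L K p v = pattern L K p v')
    (t : Fin K) :
    v >>> (p / L ^ (t : ℕ) % L) % 2 = v' >>> (p / L ^ (t : ℕ) % L) % 2 := by
  rw [pattern_eq, pattern_eq] at h
  exact Fin.mk.inj (congrFun (finFunctionFinEquiv.injective (Fin.ext h)) t)

theorem exists_bit_ne {v v' L : ℕ} (h : v ≠ v') (hv : v < 2 ^ L) (hv' : v' < 2 ^ L) :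
    ∃ b : Fin L, v >>> (b : ℕ) % 2 ≠ v' >>> (b : ℕ) % 2 := by
  by_contra! hb
  refine h (Nat.eq_of_testBit_eq fun b => ?_)
  rcases lt_or_ge b L with hlt | hge
  · simp only [Nat.testBit_eq_decide_div_mod_eq, ← Nat.shiftRight_eq_div_pow, hb ⟨b, hlt⟩]
  · have hpow : 2 ^ L ≤ 2 ^ b := Nat.pow_le_pow_right two_pos hge
    rw [Nat.testBit_lt_two_pow (hv.trans_le hpow), Nat.testBit_lt_two_pow (hv'.trans_le hpow)]

theorem exists_pattern_injective {L k : ℕ} (hL : 0 < L) {w : Fin k → ℕ}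
    (hw : ∀ i, w i < 2 ^ L) (hinj : Function.Injective w) :
    ∃ p < L ^ (k * k), Function.Injective fun i => pattern L (k * k) p (w i) := by
  have separated (q : Fin k × Fin k) : ∃ b : Fin L, q.1 ≠ q.2 →
      w q.1 >>> (b : ℕ) % 2 ≠ w q.2 >>> (b : ℕ) % 2 := by
    by_cases hq : q.1 = q.2
    · exact ⟨⟨0, hL⟩, fun hne => absurd hq hne⟩
    · obtain ⟨b, hb⟩ := exists_bit_ne (hinj.ne hq) (hw _) (hw _)
      exact ⟨b, fun _ => hb⟩
  choose position hposition using separated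
  obtain ⟨p, hp, digit⟩ := exists_digits (position ∘ finProdFinEquiv.symm)
  refine ⟨p, hp, fun i j h => ?_⟩
  by_contra hij
  have hbit := bit_eq_of_pattern_eq h (finProdFinEquiv (i, j))
  rw [digit, Function.comp_apply, Equiv.symm_apply_apply] at hbit
  exact hposition (i, j) hij hbit

/-- The colour of the number `v` in the colouring that is coded by `g`: the last `k * k` digits of
`g` in base `L` select bits of `v`, and the rest of `g` is a table, in base `2 ^ k`, of the colour
for each pattern of these bits. -/
def colour (L k g v : ℕ) : ℕ :=
  g / L ^ (k * k) / (2 ^ k) ^ pattern L (k * k) (g % L ^ (k * k)) v % 2 ^ k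

/-- The number of codes of colourings. -/
def codes (L k : ℕ) : ℕ :=
  L ^ (k * k) * (2 ^ k) ^ 2 ^ (k * k)

theorem exists_colour_eq {L k : ℕ} (hL : 0 < L) {w : Fin k → ℕ} (hw : ∀ i, w i < 2 ^ L)
    (hinj : Function.Injective w) : ∃ g < codes L k, ∀ i, colour L k g (w i) = i := by
  obtain ⟨p, hp, hpattern⟩ := exists_pattern_injective hL hw hinj
  obtain ⟨table, htable, entry⟩ := exists_digits (b := 2 ^ k) (n := 2 ^ (k * k)) fun t =>
    ⟨Function.extend (fun i => pattern L (k * k) p (w i)) Fin.val 0 t % 2 ^ k,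
      Nat.mod_lt _ (Nat.two_pow_pos k)⟩
  have hpow : 0 < L ^ (k * k) := Nat.pow_pos hL
  refine ⟨p + L ^ (k * k) * table, ?_, fun i => ?_⟩
  · calc p + L ^ (k * k) * table < L ^ (k * k) * (table + 1) := by linarith
      _ ≤ codes L k := Nat.mul_le_mul_left _ htable
  · rw [colour, Nat.add_mul_mod_self_left, Nat.mod_eq_of_lt hp, Nat.add_mul_div_left _ _ hpow,
      Nat.div_eq_of_lt hp, Nat.zero_add]
    refine (entry ⟨_, pattern_lt L (k * k) p (w i)⟩).trans ?_
    rw [hpattern.extend_apply]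
    exact Nat.mod_eq_of_lt (i.isLt.trans Nat.lt_two_pow_self)

end ColourCoding

/-! ### Closed walks through layers as coverability instances -/

/-- A graph on `k + 1` layers with `Z` slots each, in which the `R` edges lead from each layer to
the next one; there are no parallel edges, and some edges may be disabled. -/
structure LayeredGraph (k Z R : ℕ) where
  layer : Fin R → Fin k
  tail : Fin R → Fin Z
  head : Fin R → Fin Z
  enabled : Fin R → Bool
  eq_of_ends : ∀ ρ ρ', layer ρ = layer ρ' → tail ρ = tail ρ' → head ρ = head ρ' → ρ = ρ'

namespace LayeredGraph

variable {k Z R : ℕ} (G : LayeredGraph k Z R)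

/-- An enabled edge from slot `a` of layer `i` to slot `b` of the next layer. -/
def Adj (i : ℕ) (a b : Fin Z) : Prop :=
  ∃ ρ, (G.layer ρ : ℕ) = i ∧ G.tail ρ = a ∧ G.head ρ = b ∧ G.enabled ρ

/-- The slots `v 0, …, v i` form a walk from the first layer to layer `i`. -/
def Walk (i : ℕ) (v : ℕ → Fin Z) : Prop := ∀ j < i, G.Adj j (v j) (v (j + 1))

/-- A walk from the first layer to the last one that ends in the slot where it begins. -/
def HasClosedWalk : Prop := ∃ v, G.Walk k v ∧ v k = v 0

variable {G} in
theorem Walk.snoc {i : ℕ} {v : ℕ → Fin Z} (h : G.Walk i v) {b : Fin Z} (hb : G.Adj i (v i) b) :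
    G.Walk (i + 1) (Function.update v (i + 1) b) := fun j hj => by
  rw [Function.update_of_ne (a := j) (by omega)]
  rcases Nat.lt_succ_iff_lt_or_eq.1 hj with hlt | rfl
  · rw [Function.update_of_ne (by omega)]
    exact h j hlt
  · rwa [Function.update_self]

/-- The states of the coverability instance are the slots of all layers. -/
def state (i : Fin (k + 1)) (z : Fin Z) : Fin ((k + 1) * Z) := finProdFinEquiv (i, z)

theorem state_val (i : Fin (k + 1)) (z : Fin Z) : (state i z : ℕ) = z + Z * i :=
  finProdFinEquiv_apply_val _

theorem state_inj {i j : Fin (k + 1)} {y z : Fin Z} : state i y = state j z ↔ i = j ∧ y = z :=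
  finProdFinEquiv.injective.eq_iff.trans Prod.ext_iff

section transitions

/-- The type of the transitions between the states. -/
abbrev Transition (k Z : ℕ) : Type :=
  Fin ((k + 1) * Z) × (Fin 2 → ℤ) × Fin ((k + 1) * Z)

/-- The transition of an edge. A disabled edge lowers the sum of the counters for good, so that it
can be followed only in vain; in this way the number of transitions is known beforehand. -/
def cross (ρ : Fin R) : Transition k Z :=
  (state (G.layer ρ).castSucc (G.tail ρ), fun _ => (G.enabled ρ).toNat - 1,
    state (G.layer ρ).succ (G.head ρ))

theorem cross_injective : Function.Injective G.cross := fun ρ ρ' h => by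
  obtain ⟨hl, ht⟩ := state_inj.1 (congrArg Prod.fst h)
  exact G.eq_of_ends ρ ρ' (Fin.castSucc_injective _ hl) ht
    (state_inj.1 (congrArg (fun t => t.2.2) h)).2

variable [NeZero Z]

/-- In the first layer, the first counter can be increased together with the slot. -/
def up (z : Fin Z) : Transition k Z := (state 0 z, ![1, -1], state 0 (z + 1))

/-- In the last layer, the first counter can be decreased together with the slot. -/
def down (z : Fin Z) : Transition k Z :=
  (state (Fin.last k) (z + 1), ![-1, 1], state (Fin.last k) z)

/-- All transitions of the coverability instance. -/
def transitions : List (Transition k Z) :=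
  (List.finRange Z).flatMap (fun z => [up z, down z]) ++ (List.finRange R).map G.cross

theorem mem_transitions {t : Transition k Z} :
    t ∈ G.transitions ↔ (∃ z, t = up z ∨ t = down z) ∨ ∃ ρ, t = G.cross ρ := by
  simp [transitions, eq_comm]

theorem length_transitions : G.transitions.length = 2 * Z + R := by
  simp [transitions, mul_comm]

theorem up_ne_down (y z : Fin Z) : (up y : Transition k Z) ≠ down z := fun h => by
  simpa [up, down] using congrFun (congrArg (fun t => t.2.1) h) 0

theorem cross_ne_up_down (ρ : Fin R) (z : Fin Z) : G.cross ρ ≠ up z ∧ G.cross ρ ≠ down z := by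
  have update_eq : (G.cross ρ).2.1 0 = (G.cross ρ).2.1 1 := rfl
  constructor <;> rintro h <;> rw [h] at update_eq <;> simp [up, down] at update_eq

theorem nodup_transitions : G.transitions.Nodup := by
  refine List.Nodup.append (List.nodup_flatMap.2 ⟨fun z _ => ?_, ?_⟩)
    ((List.nodup_finRange R).map G.cross_injective) fun t hchain hcross => ?_
  · simp [up_ne_down]
  · refine (List.nodup_finRange Z).imp fun {y z} hne => ?_
    have up_ne : (up z : Transition k Z) ≠ up y := fun h =>
      hne (state_inj.1 (congrArg Prod.fst h)).2.symm
    have down_ne : (down z : Transition k Z) ≠ down y := fun h =>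
      hne (state_inj.1 (congrArg (fun t => t.2.2) h)).2.symm
    simp [Function.onFun, up_ne, down_ne, up_ne_down, (up_ne_down _ _).symm]
  · obtain ⟨z, -, ht⟩ := List.mem_flatMap.1 hchain
    obtain ⟨ρ, -, rfl⟩ := List.mem_map.1 hcross
    rcases List.mem_pair.1 ht with h | h
    · exact (G.cross_ne_up_down ρ z).1 h
    · exact (G.cross_ne_up_down ρ z).2 h

/-- The coverability instance: to move from `(0, Z)` in the first slot of the first layer to
`(0, Z)` in the first slot of the last layer. On a walk between the layers the first counter
remembers, modulo `Z`, the slot where the walk begins. -/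
def coverInput : UnaryCoverInput 2 where
  q := (k + 1) * Z
  V :=
    { T := G.transitions.toFinset
      nonempty := ⟨up 0, List.mem_toFinset.2 (G.mem_transitions.2 (.inl ⟨0, .inl rfl⟩))⟩ }
  unary t ht i := by
    rcases G.mem_transitions.1 (List.mem_toFinset.1 ht) with ⟨z, rfl | rfl⟩ | ⟨ρ, rfl⟩
    · fin_cases i <;> simp [up]
    · fin_cases i <;> simp [down]
    · cases h : G.enabled ρ <;> simp [cross, h]
  transitions := G.transitions
  nodup := G.nodup_transitions
  mem_transitions _ := List.mem_toFinset.symm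
  source := (state 0 0, ![0, Z])
  target := (state (Fin.last k) 0, ![0, Z])

theorem val_add_one (z : Fin Z) : ((z + 1 : Fin Z) : ℕ) = (z + 1) % Z := by
  rw [Fin.val_add, Fin.val_one', Nat.add_mod_mod]

/-- The encoding of `up z` and `down z`. -/
def chainCells (k Z z : ℕ) : List ℕ :=
  [z, 2, 0, (z + 1) % Z, (z + 1) % Z + Z * k, 0, 2, z + Z * k]

theorem encode_coverInput : G.coverInput.encode =
    [(k + 1) * Z, 2 * Z + R, 0, 0, Z, Z * k, 0, Z] ++
      (List.finRange Z).flatMap (fun z : Fin Z => chainCells k Z (z : ℕ)) ++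
      (List.finRange R).flatMap fun ρ =>
        [G.tail ρ + Z * G.layer ρ, (G.enabled ρ).toNat, (G.enabled ρ).toNat,
          G.head ρ + Z * (G.layer ρ + 1)] := by
  have encode_chain (z : Fin Z) : ([up z, down z] : List (Transition k Z)).flatMap
      UnaryCoverInput.encodeTransition = chainCells k Z z := by
    simp [UnaryCoverInput.encodeTransition, up, down, state_val, val_add_one, chainCells]
  have encode_cross (ρ : Fin R) : UnaryCoverInput.encodeTransition (G.cross ρ) =
      [G.tail ρ + Z * G.layer ρ, (G.enabled ρ).toNat, (G.enabled ρ).toNat,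
        G.head ρ + Z * (G.layer ρ + 1)] := by
    simp [UnaryCoverInput.encodeTransition, cross, state_val]
  have encode_ends : UnaryCoverInput.encodeConfig G.coverInput.source ++
      UnaryCoverInput.encodeConfig G.coverInput.target = [0, 0, Z, Z * k, 0, Z] := by
    simp [UnaryCoverInput.encodeConfig, coverInput, state_val]
  have length_eq : G.coverInput.transitions.length = 2 * Z + R := G.length_transitions
  rw [UnaryCoverInput.encode, List.append_assoc _ _ (UnaryCoverInput.encodeConfig _), encode_ends,
    length_eq]
  simp only [coverInput, transitions, List.flatMap_append, List.flatMap_assoc, List.flatMap_map,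
    encode_chain, encode_cross, List.cons_append, List.nil_append]

theorem size_coverInput : G.coverInput.size = (k + 1) * Z + (2 * Z + R) + Z + Z := by
  have card : G.coverInput.V.T.card = 2 * Z + R :=
    (List.toFinset_card_of_nodup G.nodup_transitions).trans G.length_transitions
  have norm : vecNorm (fun i : Fin 2 => ((![0, Z] i : ℕ) : ℤ)) = Z := by
    simpa [vecNorm, Fin.univ_succ] using NeZero.one_le
  rw [UnaryCoverInput.size, G.coverInput.unary.size_eq, card, Fintype.card_fin]
  exact congrArg₂ (· + ·) (congrArg₂ (· + ·) rfl norm) norm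

end transitions

section covers

/-- The state `q`, with value `a` of the first counter, is on a walk or on the way down behind
it. The last two conditions say that the first counter is, modulo `Z`, the slot where the walk
begins, minus the way that has been made down. -/
def OnTrack (q : Fin ((k + 1) * Z)) (a : ℕ) : Prop :=
  ∃ i z v, q = state i z ∧ G.Walk i v ∧ (a + v i : ZMod Z) = v 0 + z ∧ (i ≠ Fin.last k → z = v i)

variable {G} {a : ℕ}

theorem OnTrack.cross {ρ : Fin R} (h : G.OnTrack (state (G.layer ρ).castSucc (G.tail ρ)) a)
    (enabled : G.enabled ρ) : G.OnTrack (state (G.layer ρ).succ (G.head ρ)) a := by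
  obtain ⟨i, z, v, hstate, walk, counter, slot⟩ := h
  obtain ⟨rfl, rfl⟩ := state_inj.1 hstate
  have tail_eq := slot (Fin.castSucc_lt_last _).ne
  refine ⟨_, _, _, rfl, walk.snoc ⟨ρ, rfl, tail_eq, rfl, enabled⟩, ?_, fun _ => ?_⟩
  · rw [Fin.val_succ, Fin.val_castSucc, Function.update_self,
      Function.update_of_ne (Nat.succ_ne_zero _).symm]
    rw [← tail_eq] at counter
    linear_combination counter
  · rw [Fin.val_succ, Fin.val_castSucc, Function.update_self]

variable [NeZero Z]

theorem cast_add_one (z : Fin Z) : (((z + 1 : Fin Z) : ℕ) : ZMod Z) = z + 1 := by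
  rw [val_add_one, ZMod.natCast_mod, Nat.cast_succ]

theorem OnTrack.up {z : Fin Z} (h : G.OnTrack (state 0 z) a) :
    G.OnTrack (state 0 (z + 1)) (a + 1) := by
  obtain ⟨i, z', v, hstate, -, counter, -⟩ := h
  obtain ⟨rfl, rfl⟩ := state_inj.1 hstate
  refine ⟨0, z + 1, fun _ => z + 1, rfl, fun j hj => absurd hj (Nat.not_lt_zero j), ?_,
    fun _ => rfl⟩
  rw [Fin.val_zero] at counter
  rw [cast_add_one, Nat.cast_succ]
  linear_combination counter

theorem OnTrack.down {z : Fin Z} (h : G.OnTrack (state (Fin.last k) (z + 1)) (a + 1)) :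
    G.OnTrack (state (Fin.last k) z) a := by
  obtain ⟨i, z', v, hstate, walk, counter, -⟩ := h
  obtain ⟨rfl, rfl⟩ := state_inj.1 hstate
  refine ⟨_, z, v, rfl, walk, ?_, fun h => absurd rfl h⟩
  rw [cast_add_one, Nat.cast_succ] at counter
  linear_combination counter

variable (G) in
/-- An invariant of the runs from the source: the sum of the counters never increases, and as long
as it has not been lowered, the run follows a walk. -/
def Invariant (c : Fin ((k + 1) * Z) × (Fin 2 → ℕ)) : Prop :=
  c.2 0 + c.2 1 ≤ Z ∧ (c.2 0 + c.2 1 = Z → G.OnTrack c.1 (c.2 0))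

theorem Invariant.step {c c' : Fin ((k + 1) * Z) × (Fin 2 → ℕ)} (h : G.Invariant c)
    (hstep : G.coverInput.V.Step c c') : G.Invariant c' := by
  obtain ⟨x, hT, hx⟩ := hstep
  have hx₀ := hx 0
  have hx₁ := hx 1
  obtain ⟨q, u⟩ := c
  obtain ⟨q', u'⟩ := c'
  obtain ⟨hle, htrack⟩ := h
  dsimp only at hx₀ hx₁ hle htrack
  rcases G.mem_transitions.1 (List.mem_toFinset.1 hT) with ⟨z, ht | ht⟩ | ⟨ρ, ht⟩ <;> cases ht
  · rw [Matrix.cons_val_zero] at hx₀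
    rw [Matrix.cons_val_one, Matrix.cons_val_fin_one] at hx₁
    have hu : u' 0 = u 0 + 1 := by omega
    refine ⟨by dsimp only; omega, fun hsum => ?_⟩
    dsimp only at hsum ⊢
    rw [hu]
    exact (htrack (by omega)).up
  · rw [Matrix.cons_val_zero] at hx₀
    rw [Matrix.cons_val_one, Matrix.cons_val_fin_one] at hx₁
    have hu : u 0 = u' 0 + 1 := by omega
    refine ⟨by dsimp only; omega, fun hsum => ?_⟩
    dsimp only at hsum ⊢
    rw [hu] at htrack
    exact (htrack (by omega)).down
  · cases henabled : G.enabled ρ <;> rw [henabled] at hx₀ hx₁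
    · rw [Bool.toNat_false, Nat.cast_zero] at hx₀ hx₁
      dsimp only at hx₀ hx₁
      exact ⟨by dsimp only; omega, fun hsum => by dsimp only at hsum; omega⟩
    · rw [Bool.toNat_true, Nat.cast_one] at hx₀ hx₁
      dsimp only at hx₀ hx₁
      have hu : u' 0 = u 0 := by omega
      refine ⟨by dsimp only; omega, fun hsum => ?_⟩
      dsimp only at hsum ⊢
      rw [hu]
      exact (htrack (by omega)).cross henabled

theorem hasClosedWalk_of_covers
    (h : G.coverInput.V.Covers G.coverInput.source G.coverInput.target) : G.HasClosedWalk := by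
  obtain ⟨u, hu, reach⟩ := h
  have source : G.Invariant G.coverInput.source := by
    refine ⟨(Nat.zero_add Z).le, fun _ => ⟨0, 0, fun _ => 0, rfl, ?_, ?_, fun _ => rfl⟩⟩
    · exact fun j hj => absurd hj (Nat.not_lt_zero j)
    · simp [coverInput]
  have target : G.Invariant (state (Fin.last k) 0, u) := by
    refine Relation.ReflTransGen.rec (motive := fun c _ => G.Invariant c) source ?_ reach
    exact fun _ hstep ih => ih.step hstep
  have hu₁ : Z ≤ u 1 := hu 1
  obtain ⟨hle, htrack⟩ := target
  dsimp only at hle htrack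
  obtain ⟨i, z, v, hstate, walk, counter, -⟩ := htrack (by omega)
  obtain ⟨rfl, rfl⟩ := state_inj.1 hstate
  refine ⟨v, walk, Fin.ext ?_⟩
  have hu₀ : u 0 = 0 := by omega
  rw [hu₀, Fin.val_zero, Nat.cast_zero, zero_add, add_zero, ZMod.natCast_eq_natCast_iff'] at counter
  rwa [Nat.mod_eq_of_lt (Fin.isLt _), Nat.mod_eq_of_lt (Fin.isLt _)] at counter

theorem step_of_mem {t : Transition k Z} (ht : t ∈ G.transitions) {x y x' y' : ℕ}
    (h₀ : t.2.1 0 = (x' : ℤ) - x) (h₁ : t.2.1 1 = (y' : ℤ) - y) :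
    G.coverInput.V.Step (t.1, ![x, y]) (t.2.2, ![x', y']) := by
  refine ⟨t.2.1, List.mem_toFinset.2 ht, fun i => ?_⟩
  fin_cases i
  · exact h₀
  · exact h₁

theorem ofNat_succ (z : ℕ) : Fin.ofNat Z (z + 1) = Fin.ofNat Z z + 1 :=
  Fin.ext (by rw [val_add_one, Fin.val_ofNat, Fin.val_ofNat, Nat.mod_add_mod])

theorem reach_up {z : ℕ} (hz : z ≤ Z) :
    G.coverInput.V.Reach (state 0 0, ![0, Z]) (state 0 (Fin.ofNat Z z), ![z, Z - z]) := by
  induction z with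
  | zero => exact .refl
  | succ z ih =>
    rw [ofNat_succ]
    refine (ih (by omega)).tail (step_of_mem (G.mem_transitions.2 (.inl ⟨_, .inl rfl⟩)) ?_ ?_)
    · simp [up]
    · simp only [up, Matrix.cons_val_one, Matrix.cons_val_fin_one]
      omega

theorem reach_down {z : ℕ} (hz : z ≤ Z) :
    G.coverInput.V.Reach (state (Fin.last k) (Fin.ofNat Z z), ![z, Z - z])
      (state (Fin.last k) 0, ![0, Z]) := by
  induction z with
  | zero => exact .refl
  | succ z ih =>
    rw [ofNat_succ]
    refine .head (step_of_mem (G.mem_transitions.2 (.inl ⟨_, .inr rfl⟩)) ?_ ?_) (ih (by omega))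
    · simp [down]
    · simp only [down, Matrix.cons_val_one, Matrix.cons_val_fin_one]
      omega

theorem Walk.reach {v : ℕ → Fin Z} (h : G.Walk k v) (x y : ℕ) (i : Fin (k + 1)) :
    G.coverInput.V.Reach (state 0 (v 0), ![x, y]) (state i (v i), ![x, y]) := by
  induction i using Fin.induction with
  | zero => exact .refl
  | succ i ih =>
    obtain ⟨ρ, hlayer, htail, hhead, henabled⟩ := h i i.isLt
    obtain rfl : G.layer ρ = i := Fin.ext hlayer
    rw [Fin.val_castSucc, ← htail] at ih
    rw [Fin.val_succ, ← hhead]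
    refine ih.tail (step_of_mem (G.mem_transitions.2 (.inr ⟨ρ, rfl⟩)) ?_ ?_) <;>
      simp [LayeredGraph.cross, henabled]

theorem covers_iff_hasClosedWalk :
    G.coverInput.V.Covers G.coverInput.source G.coverInput.target ↔ G.HasClosedWalk := by
  refine ⟨hasClosedWalk_of_covers, ?_⟩
  rintro ⟨v, walk, hclosed⟩
  have reach_start := reach_up (G := G) (v 0).isLt.le
  have reach_end := reach_down (G := G) (v 0).isLt.le
  have reach_across := walk.reach (v 0) (Z - v 0) (Fin.last k)
  rw [Fin.ofNat_val_eq_self] at reach_start reach_end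
  rw [Fin.val_last, hclosed] at reach_across
  exact ⟨_, le_rfl, (reach_start.trans reach_across).trans reach_end⟩

end covers

end LayeredGraph

/-! ### Coloured cycles as closed walks -/

theorem hasCycle_iff_of_injOn {V W : Type*} {G : Digraph V} {H : Digraph W} {f : V → W}
    (hf : Set.InjOn f {u | ∃ v, G.Adj u v ∨ G.Adj v u})
    (hH : ∀ a b, H.Adj a b ↔ ∃ u v, G.Adj u v ∧ f u = a ∧ f v = b) (k : ℕ) :
    G.HasCycle k ↔ H.HasCycle k := by
  constructor
  · rintro ⟨v, hv, hadj⟩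
    refine ⟨f ∘ v, fun i j hij => hv (hf ?_ ?_ hij), fun i => ?_⟩
    · exact ⟨_, .inl (hadj i)⟩
    · exact ⟨_, .inl (hadj j)⟩
    · exact (hH _ _).2 ⟨_, _, hadj i, rfl, rfl⟩
  · rintro ⟨w, hw, hadj⟩
    choose u v huv hu hv using fun i => (hH _ _).1 (hadj i)
    refine ⟨u, fun i j hij => hw ?_, fun i => ?_⟩
    · rw [← hu, ← hu, hij]
    · have hnext : v i = u (i + 1) :=
        hf ⟨_, .inr (huv i)⟩ ⟨_, .inl (huv (i + 1))⟩ ((hv i).trans (hu (i + 1)).symm)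
      exact hnext ▸ huv i

theorem divNat_finProdFinEquiv {m n : ℕ} (p : Fin m × Fin n) : (finProdFinEquiv p).divNat = p.1 :=
  congrArg Prod.fst (finProdFinEquiv.symm_apply_apply p)

theorem modNat_finProdFinEquiv {m n : ℕ} (p : Fin m × Fin n) : (finProdFinEquiv p).modNat = p.2 :=
  congrArg Prod.snd (finProdFinEquiv.symm_apply_apply p)

namespace ColourCoding

variable {k N m G : ℕ}

/-- The layered graph that traces, for each of the `G` colourings, the edges whose ends have the
colour of their layer, where the colours are counted modulo `k`. A slot consists of a colouring and
a vertex, and the index of an edge of a colouring, an edge of the given graph, and a layer. -/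
def layeredGraph (k : ℕ) (edge : Fin m → Fin N × Fin N) (injective : Function.Injective edge)
    (colour : Fin G → Fin N → ℕ) : LayeredGraph k (G * N) (G * m * k) where
  layer τ := τ.modNat
  tail τ := finProdFinEquiv (τ.divNat.divNat, (edge τ.divNat.modNat).1)
  head τ := finProdFinEquiv (τ.divNat.divNat, (edge τ.divNat.modNat).2)
  enabled τ :=
    decide (colour τ.divNat.divNat (edge τ.divNat.modNat).1 = τ.modNat ∧
      colour τ.divNat.divNat (edge τ.divNat.modNat).2 = (τ.modNat + 1) % k)
  eq_of_ends τ τ' hlayer htail hhead := by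
    obtain ⟨hg, htail⟩ := Prod.ext_iff.1 (finProdFinEquiv.injective htail)
    obtain ⟨-, hhead⟩ := Prod.ext_iff.1 (finProdFinEquiv.injective hhead)
    have hedge := injective (Prod.ext htail hhead)
    have hdiv : τ.divNat = τ'.divNat := finProdFinEquiv.symm.injective (Prod.ext hg hedge)
    exact finProdFinEquiv.symm.injective (Prod.ext hdiv hlayer)

variable {edge : Fin m → Fin N × Fin N} {injective : Function.Injective edge}
  {colour : Fin G → Fin N → ℕ}

theorem adj_iff {i : ℕ} {a b : Fin (G * N)} :
    (layeredGraph k edge injective colour).Adj i a b ↔ i < k ∧ a.divNat = b.divNat ∧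
      (a.modNat, b.modNat) ∈ Set.range edge ∧ colour a.divNat a.modNat = i ∧
        colour a.divNat b.modNat = (i + 1) % k := by
  obtain ⟨⟨g, u⟩, rfl⟩ := finProdFinEquiv.surjective a
  obtain ⟨⟨g', v⟩, rfl⟩ := finProdFinEquiv.surjective b
  rw [divNat_finProdFinEquiv, divNat_finProdFinEquiv, modNat_finProdFinEquiv,
    modNat_finProdFinEquiv]
  constructor
  · rintro ⟨τ, rfl, htail, hhead, henabled⟩
    cases finProdFinEquiv.injective htail
    cases finProdFinEquiv.injective hhead
    exact ⟨Fin.isLt _, rfl, ⟨_, rfl⟩, of_decide_eq_true henabled⟩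
  · rintro ⟨hi, rfl, ⟨e, he⟩, hcolour⟩
    refine ⟨finProdFinEquiv (finProdFinEquiv (g, e), ⟨i, hi⟩), ?_⟩
    simp only [layeredGraph, divNat_finProdFinEquiv, modNat_finProdFinEquiv, he]
    exact ⟨trivial, trivial, trivial, decide_eq_true hcolour⟩

theorem hasCycle_of_hasClosedWalk [NeZero k] {H : Digraph (Fin N)}
    (hH : ∀ e, H.Adj (edge e).1 (edge e).2)
    (h : (layeredGraph k edge injective colour).HasClosedWalk) : H.HasCycle k := by
  obtain ⟨v, walk, hclosed⟩ := h
  have hadj (i : ℕ) (hi : i < k) := adj_iff.1 (walk i hi)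
  have colouring_eq (i : ℕ) (hi : i ≤ k) : (v i).divNat = (v 0).divNat := by
    induction i with
    | zero => rfl
    | succ i ih => rw [← (hadj i hi).2.1, ih (by omega)]
  have colour_eq (i : ZMod k) : colour (v 0).divNat (v i.val).modNat = i.val := by
    rw [← colouring_eq _ i.val_lt.le]
    exact (hadj _ i.val_lt).2.2.2.1
  refine ⟨fun i => (v i.val).modNat, fun i j hij => ZMod.val_injective k ?_, fun i => ?_⟩
  · rw [← colour_eq i, ← colour_eq j]
    exact congrArg _ hij
  · have hnext : v (i + 1).val = v (i.val + 1) := by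
      rw [ZMod.val_add, ZMod.val_one_eq_one_mod, Nat.add_mod_mod]
      rcases Nat.lt_or_eq_of_le (Nat.succ_le_of_lt i.val_lt) with hlt | heq
      · rw [Nat.mod_eq_of_lt hlt]
      · rw [show i.val + 1 = k from heq, Nat.mod_self, hclosed]
    obtain ⟨e, he⟩ := (hadj _ i.val_lt).2.2.1
    dsimp only
    rw [hnext]
    exact (congrArg₂ H.Adj (congrArg Prod.fst he) (congrArg Prod.snd he)).mp (hH e)

theorem hasClosedWalk_of_hasCycle [NeZero k] {H : Digraph (Fin N)}
    (hH : ∀ u v, H.Adj u v → (u, v) ∈ Set.range edge)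
    (hcolour : ∀ w : Fin k → Fin N, Function.Injective w → ∃ g, ∀ i, colour g (w i) = i)
    (h : H.HasCycle k) : (layeredGraph k edge injective colour).HasClosedWalk := by
  obtain ⟨w, hw, hadj⟩ := h
  have cast_injective : Function.Injective fun i : Fin k => ((i : ℕ) : ZMod k) := fun i j hij => by
    have hval := congrArg ZMod.val hij
    dsimp only at hval
    exact Fin.ext (by rwa [ZMod.val_natCast_of_lt i.isLt, ZMod.val_natCast_of_lt j.isLt] at hval)
  obtain ⟨g, hg⟩ := hcolour (fun i => w (i : ℕ)) (hw.comp cast_injective)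
  have colour_eq (i : ℕ) : colour g (w i) = i % k := by
    have := hg ⟨i % k, Nat.mod_lt _ (NeZero.pos k)⟩
    rwa [ZMod.natCast_mod] at this
  refine ⟨fun i => finProdFinEquiv (g, w i), fun i hi => adj_iff.2 ?_, ?_⟩
  · simp only [divNat_finProdFinEquiv, modNat_finProdFinEquiv]
    refine ⟨hi, trivial, ?_, (colour_eq i).trans (Nat.mod_eq_of_lt hi), colour_eq (i + 1)⟩
    rw [Nat.cast_succ]
    exact hH _ _ (hadj i)
  · dsimp only
    rw [ZMod.natCast_self, Nat.cast_zero]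

end ColourCoding

/-! ### The layered graph of a directed graph -/

/-- The last `i < l` with `a i = v`; it is `0` if there is none. -/
def lastIndex (a : ℕ → ℕ) : ℕ → ℕ → ℕ
  | 0, _ => 0
  | l + 1, v => if a l = v then l else lastIndex a l v

theorem lastIndex_le (a : ℕ → ℕ) (l v : ℕ) : lastIndex a l v ≤ l := by
  induction l with
  | zero => exact le_rfl
  | succ l ih =>
    rw [lastIndex]
    split_ifs
    · exact l.le_succ
    · exact ih.trans l.le_succ

theorem apply_lastIndex {a : ℕ → ℕ} {i l : ℕ} (hi : i < l) : a (lastIndex a l (a i)) = a i := by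
  induction l with
  | zero => omega
  | succ l ih =>
    rw [lastIndex]
    split_ifs with h
    · exact h
    · exact ih ((Nat.lt_succ_iff_lt_or_eq.1 hi).resolve_right fun hil => h (hil ▸ rfl))

theorem lastIndex_eq_zero {a : ℕ → ℕ} {l v : ℕ} (h : ∀ i < l, a i ≠ v) : lastIndex a l v = 0 := by
  induction l with
  | zero => rfl
  | succ l ih =>
    rw [lastIndex, if_neg (h l l.lt_succ_self), ih fun i hi => h i (hi.trans l.lt_succ_self)]

theorem getElem?_flatMap_pair {α β : Type*} (f g : α → β) (l : List α) (i : ℕ) :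
    (l.flatMap fun a => [f a, g a])[2 * i]? = l[i]?.map f ∧
      (l.flatMap fun a => [f a, g a])[2 * i + 1]? = l[i]?.map g := by
  induction l generalizing i with
  | nil => exact ⟨rfl, rfl⟩
  | cons a l ih =>
    cases i with
    | zero => exact ⟨rfl, rfl⟩
    | succ i => exact ih i

namespace DigraphInput

variable (x : DigraphInput)

theorem length_encode : x.encode.length = 2 * x.m + 2 := by
  simp [encode, m, List.length_flatMap, mul_comm]

/-- The edge at place `e` of the list of edges. -/
def get (e : Fin x.m) : Fin x.n × Fin x.n := x.edges.get e

theorem get_injective : Function.Injective x.get := x.nodup.injective_get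

theorem adj_iff_exists_get {u v : Fin x.n} : x.G.Adj u v ↔ ∃ e, x.get e = (u, v) :=
  (x.mem_edges u v).symm.trans List.mem_iff_get

/-- The tails and heads of the edges, in the order of the encoding. -/
def endpoint (i : ℕ) : ℕ := x.encode.getD (i + 2) 0

theorem endpoint_tail (e : Fin x.m) : x.endpoint (2 * e) = (x.get e).1 := by
  have h := (getElem?_flatMap_pair (fun p : Fin x.n × Fin x.n => (p.1 : ℕ)) (fun p => (p.2 : ℕ))
    x.edges e).1
  rw [List.getElem?_eq_getElem e.isLt] at h
  exact congrArg (Option.getD · 0) h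

theorem endpoint_head (e : Fin x.m) : x.endpoint (2 * e + 1) = (x.get e).2 := by
  have h := (getElem?_flatMap_pair (fun p : Fin x.n × Fin x.n => (p.1 : ℕ)) (fun p => (p.2 : ℕ))
    x.edges e).2
  rw [List.getElem?_eq_getElem e.isLt] at h
  exact congrArg (Option.getD · 0) h

theorem endpoint_lt {i : ℕ} (hi : i < 2 * x.m) : x.endpoint i < x.n := by
  obtain ⟨e, rfl | rfl⟩ : ∃ e : Fin x.m, i = 2 * e ∨ i = 2 * e + 1 :=
    ⟨⟨i / 2, by omega⟩, (Nat.mod_two_eq_zero_or_one i).imp (by simp only; omega)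
      (by simp only; omega)⟩
  · exact x.endpoint_tail e ▸ Fin.isLt _
  · exact x.endpoint_head e ▸ Fin.isLt _

/-- The new name of a vertex. There may be far more vertices than edges, so that the running time
could not depend on their number; an end of an edge is renamed to one of the places at which it
occurs in the list of edges. -/
def vertex (v : ℕ) : ℕ := lastIndex x.endpoint (2 * x.m) v

/-- The vertices are renamed to numbers below `order`, the length of the encoding. -/
def order : ℕ := 2 * x.m + 2

theorem vertex_lt (v : ℕ) : x.vertex v < x.order :=
  (lastIndex_le _ _ _).trans_lt (Nat.lt_add_of_pos_right two_pos)

theorem vertex_injOn :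
    Set.InjOn (fun v : Fin x.n => (⟨x.vertex v, x.vertex_lt v⟩ : Fin x.order))
      {u | ∃ v, x.G.Adj u v ∨ x.G.Adj v u} := by
  have apply_vertex (u : Fin x.n) (hu : ∃ v, x.G.Adj u v ∨ x.G.Adj v u) :
      x.endpoint (x.vertex u) = u := by
    obtain ⟨v, h | h⟩ := hu <;> obtain ⟨e, he⟩ := x.adj_iff_exists_get.1 h
    · have := apply_lastIndex (a := x.endpoint) (i := 2 * e) (l := 2 * x.m) (by omega)
      rwa [endpoint_tail, he] at this
    · have := apply_lastIndex (a := x.endpoint) (i := 2 * e + 1) (l := 2 * x.m) (by omega)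
      rwa [endpoint_head, he] at this
  intro u hu v hv huv
  have hval : x.vertex u = x.vertex v := congrArg Fin.val huv
  rw [Fin.ext_iff, ← apply_vertex u hu, ← apply_vertex v hv, hval]

/-- The edges between the renamed vertices. -/
def edge (e : Fin x.m) : Fin x.order × Fin x.order :=
  (⟨x.vertex (x.endpoint (2 * e)), x.vertex_lt _⟩,
    ⟨x.vertex (x.endpoint (2 * e + 1)), x.vertex_lt _⟩)

theorem edge_eq (e : Fin x.m) : x.edge e =
    (⟨x.vertex (x.get e).1, x.vertex_lt _⟩,
      ⟨x.vertex (x.get e).2, x.vertex_lt _⟩) := by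
  simp only [edge, endpoint_tail, endpoint_head]

theorem adj_get (e : Fin x.m) : x.G.Adj (x.get e).1 (x.get e).2 :=
  x.adj_iff_exists_get.2 ⟨e, rfl⟩

theorem edge_injective : Function.Injective x.edge := fun e e' h => by
  rw [edge_eq, edge_eq] at h
  have htail := x.vertex_injOn ⟨_, .inl (x.adj_get e)⟩ ⟨_, .inl (x.adj_get e')⟩
    (congrArg Prod.fst h)
  have hhead := x.vertex_injOn ⟨_, .inr (x.adj_get e)⟩ ⟨_, .inr (x.adj_get e')⟩
    (congrArg Prod.snd h)
  exact x.get_injective (Prod.ext htail hhead)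

/-- The number of bits of the renamed vertices. -/
def width : ℕ := Nat.log 2 (2 * x.m + 1) + 1

theorem order_le_two_pow_width : x.order ≤ 2 ^ x.width := Nat.lt_pow_succ_log_self one_lt_two _

/-- The number of colourings. -/
def colourings (k : ℕ) : ℕ := ColourCoding.codes x.width k

/-- The number of slots in a layer. -/
def slots (k : ℕ) : ℕ := x.colourings k * x.order

/-- The number of edges of the layered graph. -/
def arcs (k : ℕ) : ℕ := x.colourings k * x.m * k

/-- The layered graph of all the colourings of the renamed directed graph. -/
def layeredGraph (k : ℕ) : LayeredGraph k (x.slots k) (x.arcs k) :=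
  ColourCoding.layeredGraph k x.edge x.edge_injective
    fun g u => ColourCoding.colour x.width k g u

theorem hasClosedWalk_layeredGraph_iff (k : ℕ) [NeZero k] :
    (x.layeredGraph k).HasClosedWalk ↔ x.G.HasCycle k := by
  let H : Digraph (Fin x.order) := ⟨fun a b => (a, b) ∈ Set.range x.edge⟩
  have adj_iff (a b : Fin x.order) : H.Adj a b ↔ ∃ u v, x.G.Adj u v ∧
      (⟨x.vertex u, x.vertex_lt u⟩ : Fin x.order) = a ∧ ⟨x.vertex v, x.vertex_lt v⟩ = b := by
    constructor
    · rintro ⟨e, he⟩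
      rw [edge_eq] at he
      exact ⟨_, _, x.adj_get e, congrArg Prod.fst he, congrArg Prod.snd he⟩
    · rintro ⟨u, v, huv, rfl, rfl⟩
      obtain ⟨e, he⟩ := x.adj_iff_exists_get.1 huv
      exact ⟨e, by rw [edge_eq, he]⟩
  rw [hasCycle_iff_of_injOn x.vertex_injOn adj_iff]
  refine ⟨ColourCoding.hasCycle_of_hasClosedWalk fun e => ⟨e, rfl⟩,
    ColourCoding.hasClosedWalk_of_hasCycle (fun u v h => h) fun w hw => ?_⟩
  obtain ⟨g, hg, hcolour⟩ := ColourCoding.exists_colour_eq (L := x.width) (Nat.succ_pos _)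
    (fun i => (w i).isLt.trans_le x.order_le_two_pow_width) (Fin.val_injective.comp hw)
  exact ⟨⟨g, hg⟩, hcolour⟩

theorem colourings_pos (k : ℕ) : 0 < x.colourings k :=
  Nat.mul_pos (Nat.pow_pos (Nat.succ_pos _)) (Nat.pow_pos (Nat.pow_pos two_pos))

instance (k : ℕ) : NeZero (x.slots k) :=
  ⟨(Nat.mul_pos (x.colourings_pos k) (Nat.succ_pos _)).ne'⟩

/-- The encoding of the coverability instance up to the transitions. -/
def header (k : ℕ) : List ℕ :=
  [(k + 1) * x.slots k, 2 * x.slots k + x.arcs k, 0, 0, x.slots k, x.slots k * k, 0, x.slots k]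

/-- The encoding of the transition of edge `τ` of the layered graph. -/
def edgeCells (k τ : ℕ) : List ℕ :=
  let u := x.vertex (x.endpoint (2 * (τ / k % x.m)))
  let v := x.vertex (x.endpoint (2 * (τ / k % x.m) + 1))
  let g := τ / k / x.m
  let enabled := decide (ColourCoding.colour x.width k g u = τ % k ∧
    ColourCoding.colour x.width k g v = (τ % k + 1) % k)
  [u + x.order * g + x.slots k * (τ % k), enabled.toNat, enabled.toNat,
    v + x.order * g + x.slots k * (τ % k + 1)]

theorem finRange_flatMap {α : Type*} (n : ℕ) (f : ℕ → List α) :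
    ((List.finRange n).flatMap fun i : Fin n => f i) = (List.range n).flatMap f := by
  rw [← List.map_coe_finRange_eq_range, List.flatMap_map]

theorem encode_coverInput (k : ℕ) : (x.layeredGraph k).coverInput.encode =
    x.header k ++ (List.range (x.slots k)).flatMap (LayeredGraph.chainCells k (x.slots k)) ++
      (List.range (x.arcs k)).flatMap (x.edgeCells k) := by
  rw [LayeredGraph.encode_coverInput, ← finRange_flatMap, ← finRange_flatMap]
  rfl

end DigraphInput

/-! ### The program -/

namespace ColourCoding

open WordRAM

variable {V : Type}

/-- The expression for `pattern`. -/
def patternExpr (L : Expr V) : ℕ → Expr V → Expr V → Expr V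
  | 0, _, _ => 0
  | K + 1, p, v => patternExpr L K p v + v >>> (p / L ^ K % L) % 2 * .const (2 ^ K)

/-- The expression for `colour`. -/
def colourExpr (L : Expr V) (k : ℕ) (g v : Expr V) : Expr V :=
  (g / L ^ (k * k)) >>> (.const k * patternExpr L (k * k) (g % L ^ (k * k)) v) % .const (2 ^ k)

variable (s : State V) (L : Expr V)

theorem eval_patternExpr (K : ℕ) (p v : Expr V) :
    (patternExpr L K p v).eval s = pattern (L.eval s) K (p.eval s) (v.eval s) := by
  induction K with
  | zero => rfl
  | succ K ih =>
    rw [pattern, Fin.sum_univ_castSucc]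
    simp only [patternExpr, Expr.eval_add, Expr.eval_mul, Expr.eval_mod, Expr.eval_div,
      Expr.eval_pow, Expr.eval_shiftRight, Expr.eval_const, ih]
    rfl

theorem eval_colourExpr (k : ℕ) (g v : Expr V) :
    (colourExpr L k g v).eval s = colour (L.eval s) k (g.eval s) (v.eval s) := by
  simp only [colourExpr, Expr.eval_mod, Expr.eval_shiftRight, Expr.eval_div, Expr.eval_pow,
    Expr.eval_mul, Expr.eval_const, eval_patternExpr, Nat.shiftRight_eq_div_pow, pow_mul, colour]

end ColourCoding

namespace DigraphInput

/-- The variables of the program. -/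
inductive Var
  | n | m | order | width | colourings | slots | base | ptr | i | limit
  | layer | colouring | tail | head | enabled
  deriving DecidableEq, Encodable

open WordRAM ColourCoding Expr Cmd Stmt

/-- The expression with value `1` if the two values are equal, and `0` otherwise. -/
def eqExpr (a b : Expr Var) : Expr Var := 1 - ((a - b) + (b - a))

theorem eval_eqExpr (a b : Expr Var) (s : State Var) :
    (eqExpr a b).eval s = (decide (a.eval s = b.eval s)).toNat := by
  change 1 - ((a.eval s - b.eval s) + (b.eval s - a.eval s)) = _
  by_cases h : a.eval s = b.eval s
  · rw [decide_eq_true h, h, Nat.sub_self, Bool.toNat_true]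
  · rw [decide_eq_false h, Bool.toNat_false]
    omega

/-- Reads the numbers of vertices and edges. -/
def readSizes : Stmt Var :=
  block [assign .n (load 0), assign .m (load 1), assign .order (2 * var .m + 2)]

/-- Builds, behind the input, the table of the new names of the vertices. -/
def buildTable : Stmt Var :=
  forTo .i .limit (2 * var .m) [store (var .order + load (var .i + 2)) (var .i)]

/-- Counts the bits of the new names. -/
def countBits : Stmt Var :=
  forTo .i .limit (var .order)
    [assign .width (var .width + (1 - (1 - (var Var.order - 1) >>> var Var.width)))]

/-- Computes the dimensions of the layered graph and the place of the output. -/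
def computeSizes (k : ℕ) : List (Cmd Var) :=
  [assign .colourings (var .width ^ (k * k) * const ((2 ^ k) ^ 2 ^ (k * k))),
    assign .slots (var .colourings * var .order), assign .base (var .order + var .n),
    assign .ptr (var .base)]

/-- Writes the part of the output before the transitions. -/
def writeHeader (k : ℕ) : Stmt Var :=
  block <| computeSizes k ++
    emit .ptr [const (k + 1) * var .slots,
      2 * var .slots + var .colourings * var .m * const k,
      0, 0, var .slots, var .slots * const k, 0, var .slots]

/-- Writes the transitions of the two chains. -/
def writeChains (k : ℕ) : Stmt Var :=
  forTo .i .limit (var .slots) <|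
    emit .ptr [var .i, 2, 0, (var .i + 1) % var .slots,
      (var .i + 1) % var .slots + var .slots * const k, 0, 2, var .i + var .slots * const k]

/-- The expression with value `1` if the colours of the ends of an edge are those of its layer and
of the next one, and `0` otherwise. -/
def enabledExpr (k : ℕ) : Expr Var :=
  eqExpr (colourExpr (var .width) k (var .colouring) (var .tail)) (var .layer) *
    eqExpr (colourExpr (var .width) k (var .colouring) (var .head)) ((var .layer + 1) % const k)

theorem eval_enabledExpr (k : ℕ) (s : State Var) : (enabledExpr k).eval s =
    (decide (colour (s.var .width) k (s.var .colouring) (s.var .tail) = s.var .layer ∧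
      colour (s.var .width) k (s.var .colouring) (s.var .head) =
        (s.var .layer + 1) % k)).toNat := by
  have toNat_and (p q : Bool) : (p && q).toNat = p.toNat * q.toNat := by cases p <;> cases q <;> rfl
  rw [enabledExpr, eval_mul, eval_eqExpr, eval_eqExpr, eval_colourExpr, eval_colourExpr,
    Bool.decide_and, toNat_and]
  rfl

/-- Reads the edge of the layered graph with the index `i`. -/
def readEdge (k : ℕ) : List (Cmd Var) :=
  [assign .layer (var .i % const k), assign .colouring (var .i / const k / var .m),
    assign .tail (load (var .order + load (2 * (var .i / const k % var .m) + 2))),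
    assign .head (load (var .order + load (2 * (var .i / const k % var .m) + 1 + 2))),
    assign .enabled (enabledExpr k)]

/-- Writes the transitions of the edges. -/
def writeEdges (k : ℕ) : Stmt Var :=
  forTo .i .limit (var .colourings * var .m * const k) <|
    readEdge k ++ emit .ptr [var .tail + var .order * var .colouring + var .slots * var .layer,
      var .enabled, var .enabled,
      var .head + var .order * var .colouring + var .slots * (var .layer + 1)]

/-- The program that computes the coverability instance of the layered graph. -/
def reduction (k : ℕ) : Stmt Var :=
  seq readSizes <| seq buildTable <| seq countBits <| seq (writeHeader k) <|
    seq (writeChains k) (writeEdges k)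

end DigraphInput

namespace DigraphInput

open WordRAM Stmt

variable (x : DigraphInput)

/-- The first cell of the output. -/
def base : ℕ := x.order + x.n

/-- The memory after `l` rounds of `buildTable`. -/
def memory (l a : ℕ) : ℕ :=
  if a < x.order then x.encode.getD a 0 else lastIndex x.endpoint l (a - x.order)

theorem memory_zero : x.memory 0 = fun a => x.encode.getD a 0 := funext fun a => by
  rw [memory]
  split_ifs with h
  · rfl
  · rw [List.getD_eq_default _ _ (x.length_encode.trans_le (not_lt.1 h)), lastIndex]

theorem memory_add_two (l : ℕ) {i : ℕ} (hi : i < 2 * x.m) : x.memory l (i + 2) = x.endpoint i :=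
  if_pos (Nat.add_lt_add_right hi 2)

theorem memory_order_add (l v : ℕ) : x.memory l (x.order + v) = lastIndex x.endpoint l v := by
  rw [memory, if_neg (Nat.not_lt.2 (Nat.le_add_right _ _)), Nat.add_sub_cancel_left]

theorem update_memory (l : ℕ) :
    Function.update (x.memory l) (x.order + x.endpoint l) l = x.memory (l + 1) := by
  funext a
  rcases lt_or_ge a x.order with ha | ha
  · rw [Function.update_of_ne (by omega), memory, memory, if_pos ha, if_pos ha]
  · obtain ⟨v, rfl⟩ := Nat.exists_eq_add_of_le ha
    rw [memory_order_add, lastIndex, Function.update_apply, memory_order_add]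
    simp only [Nat.add_left_cancel_iff, eq_comm]

theorem memory_eq_zero {a : ℕ} (ha : x.base ≤ a) : x.memory (2 * x.m) a = 0 := by
  obtain ⟨v, rfl⟩ := Nat.exists_eq_add_of_le ha
  rw [base, add_assoc, memory_order_add]
  exact lastIndex_eq_zero fun i hi => ((x.endpoint_lt hi).trans_le (Nat.le_add_right _ _)).ne

/-- The state after `l` rounds of `buildTable`, with `w` bits counted. -/
structure HasTable (l w : ℕ) (s : State Var) : Prop where
  n_eq : s.var .n = x.n
  m_eq : s.var .m = x.m
  order_eq : s.var .order = x.order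
  width_eq : s.var .width = w
  mem_eq : s.mem = x.memory l

variable {x} {B D k : ℕ} {s : State Var}

theorem HasTable.set_loop {l w : ℕ} (h : x.HasTable l w s) (b : ℕ) :
    x.HasTable l w (s.set .i b) ∧ x.HasTable l w (s.set .limit b) :=
  ⟨⟨h.n_eq, h.m_eq, h.order_eq, h.width_eq, h.mem_eq⟩,
    ⟨h.n_eq, h.m_eq, h.order_eq, h.width_eq, h.mem_eq⟩⟩

theorem wp_readSizes (hD : 1 ≤ D) (hB : x.base ≤ B) (hs : (initState Var x.encode).Bdd B) :
    readSizes.Wp B D (x.HasTable 0 0) (initState Var x.encode) := by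
  have hm : 2 * x.m + 2 ≤ B := (Nat.le_add_right _ _).trans hB
  refine wp_block hD hs ⟨hs.2 0, hs.2 1, hm, rfl, rfl, rfl, rfl, x.memory_zero.symm⟩

theorem wp_buildTable (hD : x.order ≤ D) (hB : x.base ≤ B) (hs : s.Bdd B) (h : x.HasTable 0 0 s) :
    buildTable.Wp B D (x.HasTable (2 * x.m) 0) s := by
  have horder : x.order = 2 * x.m + 2 := rfl
  have hbase : x.base = x.order + x.n := rfl
  refine wp_forTo (by decide) (by simp [Cmd.Keeps]) (by simp [Cmd.Keeps]) (by omega) (by omega)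
    (by omega) hs (congrArg (2 * ·) h.m_eq) (x.HasTable · 0) h (fun l s b h => h.set_loop b)
    fun l hl s hi h => ⟨?_, h.n_eq, h.m_eq, h.order_eq, h.width_eq, ?_⟩
  · exact hi.trans_le (by omega)
  · change Function.update s.mem (s.var .order + s.mem (s.var .i + 2)) (s.var .i) = _
    rw [h.mem_eq, h.order_eq, hi, x.memory_add_two l hl, x.update_memory]

theorem width_le_order : x.width ≤ x.order :=
  (Nat.succ_lt_succ (Nat.log_lt_self 2 (Nat.succ_ne_zero _))).le

theorem min_width_succ (l : ℕ) : min l x.width + (1 - (1 - (x.order - 1) >>> min l x.width)) =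
    min (l + 1) x.width := by
  have hlog : 2 ^ min l x.width ≤ x.order - 1 ↔ min l x.width < x.width :=
    (Nat.le_log_iff_pow_le one_lt_two (Nat.succ_ne_zero _)).symm.trans Nat.lt_succ_iff.symm
  rw [Nat.shiftRight_eq_div_pow]
  have hdiv := Nat.div_pos_iff (a := x.order - 1) (b := 2 ^ min l x.width)
  have hpow : 0 < 2 ^ min l x.width := Nat.two_pow_pos _
  omega

theorem wp_countBits (hD : x.order ≤ D) (hB : x.base ≤ B) (hs : s.Bdd B)
    (h : x.HasTable (2 * x.m) 0 s) : countBits.Wp B D (x.HasTable (2 * x.m) x.width) s := by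
  have hbase : x.base = x.order + x.n := rfl
  refine (wp_forTo (n := x.order) (by decide) (by simp [Cmd.Keeps]) (by simp [Cmd.Keeps])
    ((Nat.succ_pos _).trans_le hD) hD (by omega) hs (by exact h.order_eq)
    (fun l => x.HasTable (2 * x.m) (min l x.width)) ?_ (fun l s b h => h.set_loop b)
    fun l _ s _ h => ?_).mono fun s h => ?_
  · rwa [Nat.zero_min]
  · have value_eq : s.var .width + (1 - (1 - (s.var .order - 1) >>> s.var .width)) =
        min (l + 1) x.width := by
      rw [h.width_eq, h.order_eq, min_width_succ]
    refine ⟨value_eq.trans_le ?_, h.n_eq, h.m_eq, h.order_eq, value_eq, h.mem_eq⟩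
    exact (min_le_right _ _).trans (width_le_order.trans (by omega))
  · rwa [min_eq_right width_le_order] at h

/-- The state when `l` is the part of the output that has been written. -/
structure HasWritten (x : DigraphInput) (k : ℕ) (l : List ℕ) (s : State Var) : Prop where
  m_eq : s.var .m = x.m
  order_eq : s.var .order = x.order
  width_eq : s.var .width = x.width
  colourings_eq : s.var .colourings = x.colourings k
  slots_eq : s.var .slots = x.slots k
  base_eq : s.var .base = x.base
  mem_eq : ∀ a < x.base, s.mem a = x.memory (2 * x.m) a
  output : s.HasOutput .ptr x.base l

namespace HasWritten

variable {l l' : List ℕ}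

theorem set (h : x.HasWritten k l s) {v : Var}
    (hv : v ∉ [Var.m, .order, .width, .colourings, .slots, .base, .ptr]) (b : ℕ) :
    x.HasWritten k l (s.set v b) := by
  have var_eq (u) (hu : u ∈ [Var.m, .order, .width, .colourings, .slots, .base, .ptr]) :
      (s.set v b).var u = s.var u :=
    Function.update_of_ne (fun huv : u = v => hv (huv ▸ hu)) _ _
  exact ⟨(var_eq _ (by decide)).trans h.m_eq, (var_eq _ (by decide)).trans h.order_eq,
    (var_eq _ (by decide)).trans h.width_eq, (var_eq _ (by decide)).trans h.colourings_eq,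
    (var_eq _ (by decide)).trans h.slots_eq, (var_eq _ (by decide)).trans h.base_eq, h.mem_eq,
    (var_eq _ (by decide)).trans h.output.1, h.output.2⟩

theorem emit (h : x.HasWritten k l s) {es : List (Expr Var)} (hes : es.all (Expr.avoids .ptr))
    (heval : es.map (Expr.eval s) = l') (hl' : ∀ b ∈ l', b ≤ B)
    (hlen : x.base + (l ++ l').length ≤ B) :
    wpBlock B (x.HasWritten k (l ++ l')) (WordRAM.emit .ptr es) s := by
  subst heval
  rw [List.length_append, List.length_map, ← Nat.add_assoc] at hlen
  refine (wpBlock_emit hes (List.forall_mem_map.1 hl') hlen h.output).mono ?_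
  rintro s' ⟨⟨var_eq, mem_eq⟩, output⟩
  exact ⟨(var_eq _ (by decide)).trans h.m_eq, (var_eq _ (by decide)).trans h.order_eq,
    (var_eq _ (by decide)).trans h.width_eq, (var_eq _ (by decide)).trans h.colourings_eq,
    (var_eq _ (by decide)).trans h.slots_eq, (var_eq _ (by decide)).trans h.base_eq,
    fun a ha => (mem_eq a ha).trans (h.mem_eq a ha), output⟩

theorem mem_vertex (h : x.HasWritten k l s) {i : ℕ} (hi : i < 2 * x.m) :
    s.mem (s.var .order + s.mem (i + 2)) = x.vertex (x.endpoint i) := by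
  have hbase : x.base = 2 * x.m + 2 + x.n := rfl
  rw [h.order_eq, h.mem_eq (i + 2) (by omega), x.memory_add_two _ hi,
    h.mem_eq _ (Nat.add_lt_add_left (x.endpoint_lt hi) _), x.memory_order_add, vertex]

end HasWritten

/-- A bound for all the values that occur. -/
def bound (x : DigraphInput) (k : ℕ) : ℕ :=
  x.base + 8 + 8 * x.slots k + 4 * x.arcs k + (k + 1) * x.slots k

theorem base_le_bound : x.base ≤ x.bound k := by
  rw [bound]
  omega

theorem bound_eq : x.bound k = x.base + 8 + 8 * x.slots k + 4 * x.arcs k +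
    (x.slots k * k + x.slots k) := by
  rw [bound]
  ring

theorem wpBlock_computeSizes (h : x.HasTable (2 * x.m) x.width s) :
    wpBlock (x.bound k) (x.HasWritten k []) (computeSizes k) s := by
  have hslots : x.colourings k ≤ x.slots k := Nat.le_mul_of_pos_right _ (Nat.succ_pos _)
  have hbound := x.bound_eq (k := k)
  have colourings_eq : (Expr.var .width ^ (k * k) * .const ((2 ^ k) ^ 2 ^ (k * k))).eval s =
      x.colourings k := by
    rw [Expr.eval_mul, Expr.eval_pow, Expr.eval_var, h.width_eq]
    rfl
  have slots_eq : (Expr.var .width ^ (k * k) * .const ((2 ^ k) ^ 2 ^ (k * k))).eval s *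
      s.var .order = x.slots k := by
    rw [colourings_eq, h.order_eq, slots]
  have base_eq : s.var .order + s.var .n = x.base := by rw [h.order_eq, h.n_eq, base]
  refine ⟨colourings_eq.trans_le (by omega), slots_eq.trans_le (by omega),
    base_eq.trans_le (by omega), base_eq.trans_le (by omega), h.m_eq, h.order_eq, h.width_eq,
    colourings_eq, slots_eq, base_eq, fun a _ => congrFun h.mem_eq a, base_eq, fun i => ?_⟩
  exact (congrFun h.mem_eq _).trans (x.memory_eq_zero (Nat.le_add_right _ _))

theorem wp_writeHeader (hD : 1 ≤ D) (hs : s.Bdd (x.bound k))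
    (h : x.HasTable (2 * x.m) x.width s) :
    (writeHeader k).Wp (x.bound k) D (x.HasWritten k (x.header k)) s := by
  have hbound := x.bound_eq (k := k)
  refine wp_block hD hs (wpBlock_append.2 ((wpBlock_computeSizes h).mono fun s h =>
    h.emit (l' := x.header k) rfl ?_ ?_ ?_))
  · change [(k + 1) * s.var .slots, 2 * s.var .slots + s.var .colourings * s.var .m * k,
      0, 0, s.var .slots, s.var .slots * k, 0, s.var .slots] = _
    rw [h.slots_eq, h.colourings_eq, h.m_eq, header, arcs]
  · rw [header, Nat.succ_mul, Nat.mul_comm k]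
    simp only [List.forall_mem_cons, List.not_mem_nil, IsEmpty.forall_iff, implies_true,
      and_true]
    omega
  · rw [List.nil_append, header]
    simp only [List.length_cons, List.length_nil]
    omega

/-- The output after `l` rounds of `writeChains`. -/
def chainOutput (x : DigraphInput) (k l : ℕ) : List ℕ :=
  x.header k ++ (List.range l).flatMap (LayeredGraph.chainCells k (x.slots k))

theorem chainOutput_succ (l : ℕ) : x.chainOutput k (l + 1) =
    x.chainOutput k l ++ LayeredGraph.chainCells k (x.slots k) l := by
  rw [chainOutput, chainOutput, List.range_succ, List.flatMap_append, List.flatMap_singleton,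
    List.append_assoc]

theorem length_chainOutput (l : ℕ) : (x.chainOutput k l).length = 8 + 8 * l := by
  induction l with
  | zero => rfl
  | succ l ih =>
    rw [chainOutput_succ, List.length_append, ih]
    rfl

theorem HasWritten.set_loop {l : List ℕ} (h : x.HasWritten k l s) (b : ℕ) :
    x.HasWritten k l (s.set .i b) ∧ x.HasWritten k l (s.set .limit b) :=
  ⟨h.set (by decide) b, h.set (by decide) b⟩

theorem keeps_emit {v : Var} (hv : v ≠ .ptr) (es : List (Expr Var)) :
    ∀ c ∈ WordRAM.emit .ptr es, c.Keeps v := by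
  intro c hc
  obtain ⟨e, -, hc⟩ := List.mem_flatMap.1 hc
  fin_cases hc
  · trivial
  · exact hv

theorem wp_writeChains (hD : x.slots k ≤ D) (hs : s.Bdd (x.bound k))
    (h : x.HasWritten k (x.header k) s) :
    (writeChains k).Wp (x.bound k) D (x.HasWritten k (x.chainOutput k (x.slots k))) s := by
  have hbound := x.bound_eq (k := k)
  have hpos : 0 < x.slots k := Nat.pos_of_neZero _
  refine wp_forTo (by decide) (keeps_emit (by decide) _) (keeps_emit (by decide) _)
    (by omega) hD (by omega) hs (by exact h.slots_eq) (fun l => x.HasWritten k (x.chainOutput k l))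
    (by rwa [chainOutput, List.range_zero, List.flatMap_nil, List.append_nil])
    (fun l s b h => h.set_loop b) fun l hl s hi h => ?_
  rw [chainOutput_succ]
  refine h.emit rfl ?_ ?_ ?_
  · change [s.var .i, 2, 0, (s.var .i + 1) % s.var .slots,
      (s.var .i + 1) % s.var .slots + s.var .slots * k, 0, 2, s.var .i + s.var .slots * k] = _
    rw [h.slots_eq, hi, LayeredGraph.chainCells]
  · have hmod := Nat.mod_lt (l + 1) hpos
    rw [LayeredGraph.chainCells]
    simp only [List.forall_mem_cons, List.not_mem_nil, IsEmpty.forall_iff, implies_true,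
      and_true]
    omega
  · rw [← chainOutput_succ, length_chainOutput]
    omega

/-- The state when edge `τ` of the layered graph has been read. -/
structure HasRead (x : DigraphInput) (k τ : ℕ) (l : List ℕ) (s : State Var) : Prop
    extends x.HasWritten k l s where
  layer_eq : s.var .layer = τ % k
  colouring_eq : s.var .colouring = τ / k / x.m
  tail_eq : s.var .tail = x.vertex (x.endpoint (2 * (τ / k % x.m)))
  head_eq : s.var .head = x.vertex (x.endpoint (2 * (τ / k % x.m) + 1))
  enabled_eq : s.var .enabled = (decide
    (ColourCoding.colour x.width k (s.var .colouring) (s.var .tail) = s.var .layer ∧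
      ColourCoding.colour x.width k (s.var .colouring) (s.var .head) =
        (s.var .layer + 1) % k)).toNat

theorem arc_bounds {τ : ℕ} (hτ : τ < x.arcs k) :
    τ % k < k ∧ τ / k / x.m < x.colourings k ∧ τ / k % x.m < x.m := by
  have hk : 0 < k := Nat.pos_of_ne_zero fun hk => by simp [arcs, hk] at hτ
  have hm : 0 < x.m := Nat.pos_of_ne_zero fun hm => by simp [arcs, hm] at hτ
  refine ⟨Nat.mod_lt _ hk, ?_, Nat.mod_lt _ hm⟩
  exact (Nat.div_lt_iff_lt_mul hm).2 ((Nat.div_lt_iff_lt_mul hk).2 hτ)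

theorem wpBlock_readEdge {l : List ℕ} {τ : ℕ} (hτ : τ < x.arcs k) (hi : s.var .i = τ)
    (h : x.HasWritten k l s) : wpBlock (x.bound k) (x.HasRead k τ l) (readEdge k) s := by
  have hbound := x.bound_eq (k := k)
  have horder : x.base = x.order + x.n := rfl
  obtain ⟨layer_lt, colouring_lt, edge_lt⟩ := x.arc_bounds hτ
  have hslots : x.colourings k ≤ x.slots k := Nat.le_mul_of_pos_right _ (Nat.succ_pos _)
  have hlayer : k ≤ x.slots k * k := Nat.le_mul_of_pos_left _ (Nat.pos_of_neZero _)
  have layer_eq : s.var .i % k = τ % k := by rw [hi]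
  have colouring_eq : s.var .i / k / s.var .m = τ / k / x.m := by rw [hi, h.m_eq]
  have tail_eq : s.mem (s.var .order + s.mem (2 * (s.var .i / k % s.var .m) + 2)) =
      x.vertex (x.endpoint (2 * (τ / k % x.m))) := by
    rw [hi, h.m_eq, h.mem_vertex (by omega)]
  have head_eq : s.mem (s.var .order + s.mem (2 * (s.var .i / k % s.var .m) + 1 + 2)) =
      x.vertex (x.endpoint (2 * (τ / k % x.m) + 1)) := by
    rw [hi, h.m_eq, h.mem_vertex (by omega)]
  have tail_le := (x.vertex_lt (x.endpoint (2 * (τ / k % x.m)))).le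
  have head_le := (x.vertex_lt (x.endpoint (2 * (τ / k % x.m) + 1))).le
  refine ⟨layer_eq.trans_le (by omega), colouring_eq.trans_le (by omega),
    tail_eq.trans_le (by omega), head_eq.trans_le (by omega),
    (eval_enabledExpr k _).trans_le ((Bool.toNat_le _).trans (by omega)),
    ((((h.set (by decide) _).set (by decide) _).set (by decide) _).set (by decide) _).set
      (by decide) _, layer_eq, colouring_eq, tail_eq, head_eq, ?_⟩
  refine (eval_enabledExpr k _).trans ?_
  rw [← h.width_eq]
  rfl

/-- The output after `l` rounds of `writeEdges`. -/
def edgeOutput (x : DigraphInput) (k l : ℕ) : List ℕ :=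
  x.chainOutput k (x.slots k) ++ (List.range l).flatMap (x.edgeCells k)

theorem edgeOutput_succ (l : ℕ) : x.edgeOutput k (l + 1) =
    x.edgeOutput k l ++ x.edgeCells k l := by
  rw [edgeOutput, edgeOutput, List.range_succ, List.flatMap_append, List.flatMap_singleton,
    List.append_assoc]

theorem length_edgeOutput (l : ℕ) : (x.edgeOutput k l).length = 8 + 8 * x.slots k + 4 * l := by
  induction l with
  | zero => exact (congrArg List.length (List.append_nil _)).trans (length_chainOutput _)
  | succ l ih =>
    rw [edgeOutput_succ, List.length_append, ih]
    rfl

theorem le_bound_of_mem_edgeCells {τ : ℕ} (hτ : τ < x.arcs k) :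
    ∀ b ∈ x.edgeCells k τ, b ≤ x.bound k := by
  have hbound := x.bound_eq (k := k)
  obtain ⟨layer_lt, colouring_lt, -⟩ := x.arc_bounds hτ
  have slot_lt (u : ℕ) : x.vertex u + x.order * (τ / k / x.m) < x.slots k := by
    calc x.vertex u + x.order * (τ / k / x.m) < x.order + x.order * (τ / k / x.m) :=
          Nat.add_lt_add_right (x.vertex_lt u) _
      _ = x.order * (τ / k / x.m + 1) := by ring
      _ ≤ x.order * x.colourings k := Nat.mul_le_mul_left _ colouring_lt
      _ = x.slots k := Nat.mul_comm _ _
  have head_layer : x.slots k * (τ % k + 1) ≤ x.slots k * k := Nat.mul_le_mul_left _ layer_lt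
  have tail_layer : x.slots k * (τ % k) ≤ x.slots k * (τ % k + 1) :=
    Nat.mul_le_mul_left _ (Nat.le_succ _)
  have tail_lt := slot_lt (x.endpoint (2 * (τ / k % x.m)))
  have head_lt := slot_lt (x.endpoint (2 * (τ / k % x.m) + 1))
  have enabled_le (b : Bool) : b.toNat ≤ x.bound k := b.toNat_le.trans (by omega)
  simp only [edgeCells, List.forall_mem_cons, List.not_mem_nil, IsEmpty.forall_iff, implies_true,
    and_true, enabled_le, true_and]
  omega

theorem keeps_readEdge {v : Var} (hv : v ∈ [Var.i, .limit]) : ∀ c ∈ readEdge k, c.Keeps v := by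
  simp only [readEdge, List.forall_mem_cons, Cmd.Keeps]
  fin_cases hv <;> simp

theorem wp_writeEdges (hD : 1 ≤ D) (hD' : x.arcs k ≤ D) (hs : s.Bdd (x.bound k))
    (h : x.HasWritten k (x.chainOutput k (x.slots k)) s) :
    (writeEdges k).Wp (x.bound k) D (x.HasWritten k (x.edgeOutput k (x.arcs k))) s := by
  have hbound := x.bound_eq (k := k)
  have keeps {v : Var} (hv : v ∈ [Var.i, .limit]) (hptr : v ≠ .ptr) (es : List (Expr Var)) :
      ∀ c ∈ readEdge k ++ WordRAM.emit .ptr es, c.Keeps v :=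
    List.forall_mem_append.2 ⟨keeps_readEdge hv, keeps_emit hptr es⟩
  refine wp_forTo (n := x.arcs k) (by decide) (keeps (by decide) (by decide) _)
    (keeps (by decide) (by decide) _) hD hD' (by omega) hs ?_
    (fun l => x.HasWritten k (x.edgeOutput k l))
    (by rwa [edgeOutput, List.range_zero, List.flatMap_nil, List.append_nil])
    (fun l s b h => h.set_loop b) fun l hl s hi h => ?_
  · change s.var .colourings * s.var .m * k = _
    rw [h.colourings_eq, h.m_eq, arcs]
  rw [edgeOutput_succ]
  refine wpBlock_append.2 ((wpBlock_readEdge hl hi h).mono fun s h =>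
    h.toHasWritten.emit rfl ?_ (le_bound_of_mem_edgeCells hl) ?_)
  · change [s.var .tail + s.var .order * s.var .colouring + s.var .slots * s.var .layer,
      s.var .enabled, s.var .enabled,
      s.var .head + s.var .order * s.var .colouring + s.var .slots * (s.var .layer + 1)] = _
    rw [h.enabled_eq, h.layer_eq, h.tail_eq, h.head_eq, h.colouring_eq, h.slots_eq, h.order_eq,
      edgeCells]
  · rw [← edgeOutput_succ, length_edgeOutput]
    omega

theorem bdd_initState : (initState Var x.encode).Bdd (x.bound k) := by
  have hbase : x.base ≤ x.bound k := base_le_bound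
  have horder : x.base = 2 * x.m + 2 + x.n := rfl
  refine ⟨fun _ => Nat.zero_le _, fun a => ?_⟩
  match a with
  | 0 =>
    change x.n ≤ _
    omega
  | 1 =>
    change x.m ≤ _
    omega
  | i + 2 =>
    rcases lt_or_ge i (2 * x.m) with hi | hi
    · have hlt := x.endpoint_lt hi
      change x.endpoint i ≤ _
      omega
    · have hlength := x.length_encode
      exact (List.getD_eq_default _ _ (by omega)).trans_le (Nat.zero_le _)

theorem wp_reduction (hD : x.order + x.slots k + x.arcs k ≤ D) :
    (reduction k).Wp (x.bound k) D (HasInput .base (x.layeredGraph k).coverInput.encode)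
      (initState Var x.encode) := by
  have hbase : x.base ≤ x.bound k := base_le_bound
  have horder : x.order = 2 * x.m + 2 := rfl
  refine wp_seq ((wp_readSizes (by omega) hbase bdd_initState).mono fun _ h hs => ?_)
  refine wp_seq ((wp_buildTable (by omega) hbase hs h).mono fun _ h hs => ?_)
  refine wp_seq ((wp_countBits (by omega) hbase hs h).mono fun _ h hs => ?_)
  refine wp_seq ((wp_writeHeader (by omega) hs h).mono fun _ h hs => ?_)
  refine wp_seq ((wp_writeChains (by omega) hs h).mono fun _ h hs => ?_)
  refine (wp_writeEdges (by omega) (by omega) hs h).mono fun s h => ?_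
  rw [encode_coverInput, HasInput, h.base_eq]
  exact h.output.2

end DigraphInput

/-! ### Bounds -/

theorem rpow_two_sub_le {y s C ε ε' : ℝ} (hy : 1 ≤ y) (hs : 1 ≤ s) (hε' : 0 ≤ ε')
    (hε'_le : ε' ≤ 1 / 2) (hε : ε' ≤ ε) (h : s ≤ C * y ^ (1 + ε' / 4)) :
    s ^ (2 - ε) ≤ C ^ (2 - ε') * y ^ (2 - ε' / 2) := by
  have hC : 0 ≤ C :=
    nonneg_of_mul_nonneg_left (zero_le_one.trans (hs.trans h)) (by positivity)
  calc s ^ (2 - ε) ≤ s ^ (2 - ε') := Real.rpow_le_rpow_of_exponent_le hs (by linarith)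
    _ ≤ (C * y ^ (1 + ε' / 4)) ^ (2 - ε') :=
        Real.rpow_le_rpow (by linarith) h (by linarith)
    _ = C ^ (2 - ε') * y ^ ((1 + ε' / 4) * (2 - ε')) := by
        rw [Real.mul_rpow hC (by positivity), ← Real.rpow_mul (by positivity)]
    _ ≤ C ^ (2 - ε') * y ^ (2 - ε' / 2) := by
        gcongr ?_ * ?_
        exact Real.rpow_le_rpow_of_exponent_le hy (by nlinarith)

namespace DigraphInput

variable (x : DigraphInput)

theorem bound_le_pow (k : ℕ) {Θ : ℕ} (hΘ : 2 ≤ Θ) (hx : x.n + x.m < Θ) :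
    x.bound k ≤ Θ ^ (2 * (k * k) + k * 2 ^ (k * k) + 5 * k + 21) := by
  have order_le : x.order ≤ Θ ^ 2 := by
    rw [order]
    nlinarith
  have colourings_le : x.colourings k ≤ Θ ^ (2 * (k * k) + k * 2 ^ (k * k)) := by
    rw [colourings, ColourCoding.codes, pow_add, pow_mul Θ 2, pow_mul Θ k]
    exact Nat.mul_le_mul (Nat.pow_le_pow_left (width_le_order.trans order_le) _)
      (Nat.pow_le_pow_left (Nat.pow_le_pow_left hΘ _) _)
  have slots_le : x.slots k ≤ Θ ^ (2 * (k * k) + k * 2 ^ (k * k) + 2) :=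
    (Nat.mul_le_mul colourings_le order_le).trans_eq (pow_add ..).symm
  have le_pow : Θ ≤ Θ ^ (2 * (k * k) + k * 2 ^ (k * k) + 2) := Nat.le_self_pow (by omega) _
  have order_le_slots : x.order ≤ x.slots k := Nat.le_mul_of_pos_left _ (x.colourings_pos k)
  have arcs_le : x.arcs k ≤ x.slots k * k := by
    refine Nat.mul_le_mul_right _ (Nat.mul_le_mul_left _ ?_)
    rw [order]
    omega
  have factor_le : 5 * k + 19 ≤ Θ ^ (5 * k + 19) :=
    Nat.lt_two_pow_self.le.trans (Nat.pow_le_pow_left hΘ _)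
  calc x.bound k ≤ (5 * k + 18) * x.slots k + Θ := by
        rw [bound, base]
        have pos : 0 < x.slots k := Nat.pos_of_neZero _
        linarith
    _ ≤ (5 * k + 19) * Θ ^ (2 * (k * k) + k * 2 ^ (k * k) + 2) := by
        linarith [Nat.mul_le_mul_left (5 * k + 18) slots_le]
    _ ≤ Θ ^ (5 * k + 19) * Θ ^ (2 * (k * k) + k * 2 ^ (k * k) + 2) :=
        Nat.mul_le_mul_right _ factor_le
    _ = Θ ^ (2 * (k * k) + k * 2 ^ (k * k) + 5 * k + 21) := by
        rw [← pow_add]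
        congr 1
        ring

theorem two_le_bound (k : ℕ) : 2 ≤ x.bound k := by
  rw [bound]
  omega

theorem one_le_size_coverInput (k : ℕ) : 1 ≤ (x.layeredGraph k).coverInput.size := by
  have pos : 0 < x.slots k := Nat.pos_of_neZero _
  rw [LayeredGraph.size_coverInput]
  omega

theorem size_coverInput_le_bound (k : ℕ) : (x.layeredGraph k).coverInput.size ≤ x.bound k := by
  rw [LayeredGraph.size_coverInput, bound]
  omega

theorem steps_le (k : ℕ) :
    x.order + x.slots k + x.arcs k ≤ (k + 4) * (x.colourings k * (x.m + 1)) := by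
  have := x.colourings_pos k
  rw [slots, arcs, order]
  nlinarith [Nat.zero_le (x.colourings k * k)]

theorem size_coverInput_le (k : ℕ) : (x.layeredGraph k).coverInput.size ≤
    (3 * k + 10) * (x.colourings k * (x.m + 1)) := by
  rw [LayeredGraph.size_coverInput, slots, arcs, order]
  nlinarith [Nat.zero_le (x.colourings k * k)]

theorem exists_width_le {η : ℝ} (hη : 0 < η) :
    ∃ c : ℝ, ∀ x : DigraphInput, (x.width : ℝ) ≤ c * ((x.m : ℝ) + 1) ^ η := by
  refine ⟨4 ^ η / η / Real.log 2, fun x => ?_⟩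
  have pow_width_le : (2 : ℝ) ^ x.width ≤ 4 * ((x.m : ℝ) + 1) := by
    have hlog : 2 ^ Nat.log 2 (2 * x.m + 1) ≤ 2 * x.m + 1 :=
      Nat.pow_log_le_self 2 (Nat.succ_ne_zero _)
    have : 2 ^ x.width ≤ 4 * (x.m + 1) := by
      rw [width, pow_succ]
      omega
    exact_mod_cast this
  rw [div_mul_eq_mul_div, le_div_iff₀ (Real.log_pos one_lt_two), ← Real.log_pow,
    div_mul_eq_mul_div, ← Real.mul_rpow (by positivity) (by positivity)]
  exact (Real.log_le_log (by positivity) pow_width_le).trans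
    (Real.log_le_rpow_div (by positivity) hη)

theorem exists_colourings_le (k : ℕ) {δ : ℝ} (hδ : 0 < δ) : ∃ C : ℝ, 0 ≤ C ∧
    ∀ x : DigraphInput, ((x.colourings k * (x.m + 1) : ℕ) : ℝ) ≤
      C * ((x.m : ℝ) + 1) ^ (1 + δ) := by
  obtain ⟨c, hc⟩ := exists_width_le (η := δ / (k * k + 1)) (by positivity)
  refine ⟨|c| ^ (k * k) * (2 ^ k) ^ 2 ^ (k * k), by positivity, fun x => ?_⟩
  set y : ℝ := (x.m : ℝ) + 1
  have one_le : 1 ≤ y := le_add_of_nonneg_left (Nat.cast_nonneg _)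
  have exponent_le : δ / (k * k + 1) * ((k * k : ℕ) : ℝ) ≤ δ := by
    rw [div_mul_eq_mul_div, div_le_iff₀ (by positivity)]
    push_cast
    linarith
  have pow_width_le : (x.width : ℝ) ^ (k * k) ≤ |c| ^ (k * k) * y ^ δ := by
    calc (x.width : ℝ) ^ (k * k) ≤ (|c| * y ^ (δ / (k * k + 1))) ^ (k * k) :=
          pow_le_pow_left₀ (Nat.cast_nonneg _) ((hc x).trans (by gcongr; exact le_abs_self c)) _
      _ = |c| ^ (k * k) * y ^ (δ / (k * k + 1) * ((k * k : ℕ) : ℝ)) := by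
          rw [mul_pow, ← Real.rpow_mul_natCast (by positivity)]
      _ ≤ |c| ^ (k * k) * y ^ δ := by gcongr
  calc ((x.colourings k * (x.m + 1) : ℕ) : ℝ)
      = (x.width : ℝ) ^ (k * k) * (2 ^ k) ^ 2 ^ (k * k) * y := by
        rw [colourings, ColourCoding.codes]
        push_cast
        rfl
    _ ≤ |c| ^ (k * k) * y ^ δ * (2 ^ k) ^ 2 ^ (k * k) * y := by gcongr
    _ = |c| ^ (k * k) * (2 ^ k) ^ 2 ^ (k * k) * y ^ (1 + δ) := by
        rw [Real.rpow_add (by positivity), Real.rpow_one]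
        ring

theorem decidableInTime_hasCycle {ε : ℝ} (hε : 0 < ε) {k : ℕ} (hk : 1 ≤ k)
    (h : WordRAM.DecidableInTime (UnaryCoverInput.encode (d := 2))
      (fun x => x.V.Covers x.source x.target)
      (fun x => x.size) (fun x => (x.size : ℝ) ^ (2 - ε))) :
    WordRAM.DecidableInTime DigraphInput.encode (fun x => x.G.HasCycle k)
      (fun x => x.n + x.m) (fun x => ((x.m : ℝ) + 1) ^ (2 - min ε (1 / 2) / 2)) := by
  have : NeZero k := ⟨Nat.one_le_iff_ne_zero.1 hk⟩
  set ε' := min ε (1 / 2)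
  have hε' : 0 < ε' := lt_min hε (by norm_num)
  have hε'_le : ε' ≤ 1 / 2 := min_le_right _ _
  obtain ⟨C, hC, colourings_le⟩ := exists_colourings_le k (δ := ε' / 4) (by positivity)
  have one_le (x : DigraphInput) : 1 ≤ (x.m : ℝ) + 1 := le_add_of_nonneg_left (Nat.cast_nonneg _)
  refine h.of_reduction (fun x => (x.layeredGraph k).coverInput)
    (fun x => LayeredGraph.covers_iff_hasClosedWalk.trans (x.hasClosedWalk_layeredGraph_iff k))
    (reduction k) .base (bound · k) (fun x => x.order + x.slots k + x.arcs k) (two_le_bound · k)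
    (fun x => wp_reduction le_rfl) (2 * (k * k) + k * 2 ^ (k * k) + 5 * k + 21) (fun x => ?_)
    (size_coverInput_le_bound · k) ((k + 4) * C) (((3 * k + 10) * C) ^ (2 - ε'))
    (fun x => ?_) (fun x => ?_)
  · rw [mul_comm, pow_mul]
    exact x.bound_le_pow k (Nat.le_self_pow (Nat.succ_ne_zero _) 2)
      (Nat.lt_pow_succ_log_self one_lt_two _)
  · calc ((x.order + x.slots k + x.arcs k : ℕ) : ℝ)
        ≤ (k + 4) * ((x.colourings k * (x.m + 1) : ℕ) : ℝ) := by exact_mod_cast x.steps_le k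
      _ ≤ (k + 4) * (C * ((x.m : ℝ) + 1) ^ (1 + ε' / 4)) := by
          gcongr
          exact colourings_le x
      _ ≤ (k + 4) * (C * ((x.m : ℝ) + 1) ^ (2 - ε' / 2)) := by
          gcongr
          · exact one_le x
          · linarith
      _ = (k + 4) * C * ((x.m : ℝ) + 1) ^ (2 - ε' / 2) := (mul_assoc _ _ _).symm
  · rw [abs_of_nonneg (by positivity)]
    refine rpow_two_sub_le (one_le x) ?_ hε'.le hε'_le (min_le_left _ _) ?_
    · exact_mod_cast x.one_le_size_coverInput k
    · calc ((x.layeredGraph k).coverInput.size : ℝ)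
          ≤ (3 * k + 10) * ((x.colourings k * (x.m + 1) : ℕ) : ℝ) := by
            exact_mod_cast x.size_coverInput_le k
        _ ≤ (3 * k + 10) * (C * ((x.m : ℝ) + 1) ^ (1 + ε' / 4)) := by
            gcongr
            exact colourings_le x
        _ = (3 * k + 10) * C * ((x.m : ℝ) + 1) ^ (1 + ε' / 4) := (mul_assoc _ _ _).symm

end DigraphInput

theorem mainTheorem6 (hyp : KCycleHypothesis) (ε : ℝ) (hε : 0 < ε) :
    ¬ WordRAM.DecidableInTime (UnaryCoverInput.encode (d := 2))
      (fun x => x.V.Covers x.source x.target)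
      (fun x => x.size) (fun x => (x.size : ℝ) ^ (2 - ε)) := by
  intro h
  obtain ⟨k, hk, hno⟩ := hyp (min ε (1 / 2) / 2) (half_pos (lt_min hε (by norm_num)))
  exact hno (DigraphInput.decidableInTime_hasCycle hε hk h)
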